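/- Corollary 4.1. Write $1/\infty=0$. For a function $f$ on $[0,1]$ let $f^*$ be the non-increasing rearrangement of $|f|$; for a family $c=(c_n)_{n\in I}$ of complex numbers let $(c_k^*)_{k\ge 1}$ be the non-increasing rearrangement of $(|c_n|)_{n\in I}$. For $0<q\le\infty$ and real $\alpha,\beta$ put $$\|c\|_{l_{2,q}(\log l)_\beta}=\Big\|\,\big(k^{1/2-1/q}(1+\log k)^\beta c_k^*\big)_{k\ge 1}\Big\|_{l_q},\qquad \|f\|_{L^{\mathcal L}_{2,q,\alpha,2}}=\Big\|\,t^{-1/q}(1+|\log t|)^\alpha\,\|f^*\|_{L_2(0,t)}\Big\|_{L_q(0,1)}$$ (with $L_q(0,1)$ taken in the variable $t$), and let $l_{2,q}(\log l)_\beta$ and $L^{\mathcal L}_{2,q,\alpha,2}$ be the spaces of all families $c$, respectively of all measurable functions $f:[0,1]\to\mathbb C$, for which these expressions are finite. Let $0<q\le\infty$, $\alpha>-1/q$ and $\varepsilon>0$. There is a constant $C>0$, depending only on $q,\alpha,\varepsilon$, with the following property. Let $(\varphi_n)_{n\in I}$, with $I$ a countably infinite index set (such as $\mathbb N$ or $\mathbb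 Z$), be an orthonormal system in $L_2(0,1)$ with $M:=\sup_n\|\varphi_n\|_{L_\infty}<\infty$. Then for every $c\in l_{2,q}(\log l)_{\alpha+1/\min(q,2)}$ the series $\mathcal F^{-1}c:=\sum_{n} c_n\varphi_n$ converges unconditionally in $L_2(0,1)$, its sum belongs to $L^{\mathcal L}_{2,q,\alpha,2}$, and $$\|\mathcal F^{-1}c\|_{L^{\mathcal L}_{2,q,\alpha,2}}\le C\,\min\big(M,(1+\log M)^{|\alpha|+\varepsilon+1/q}\big)\,\|c\|_{l_{2,q}(\log l)_{\alpha+1/\min(q,2)}}.$$ -/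

import Mathlib

open MeasureTheory Set
open scoped ENNReal

noncomputable section

/-- Lebesgue measure on `[0,1]`. -/
abbrev unitVol : Measure ℝ := volume.restrict (Icc (0 : ℝ) 1)

/-- The non-increasing rearrangement on `[0,1]`: `f^*(t) = inf {s ≥ 0 : |{x : |f x| > s}| ≤ t}`. -/
def fnRearr (f : ℝ → ℂ) (t : ℝ) : ℝ≥0∞ :=
  sInf {s : ℝ≥0∞ | unitVol {x | s < ‖f x‖ₑ} ≤ ENNReal.ofReal t}

/-- The non-increasing rearrangement of a family of numbers; for `k ≥ 1`, the `k`-th term is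
`c_k^* = inf {s ≥ 0 : #{n : |c n| > s} < k}`, the `k`-th largest modulus. -/
def seqRearr {ι : Type*} (c : ι → ℂ) (k : ℕ) : ℝ≥0∞ :=
  sInf {s : ℝ≥0∞ | {n | s < ‖c n‖ₑ}.encard < k}

/-- The reciprocal `1/q` of an exponent `0 < q ≤ ∞`, with `1/∞ = 0`. -/
def recip (q : ℝ≥0∞) : ℝ := (q⁻¹).toReal

/-- The (quasi-)norm of the Lorentz–Zygmund sequence space `l_{p,q}(log l)_α`:
the `l_q` (quasi-)norm of `k^{1/p-1/q} (1 + log k)^α c_k^*`, `k = 1, 2, …`. -/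
def lzSeqNorm {ι : Type*} (p q : ℝ≥0∞) (α : ℝ) (c : ι → ℂ) : ℝ≥0∞ :=
  eLpNorm (fun j : ℕ =>
    ENNReal.ofReal (((j + 1 : ℕ) : ℝ) ^ (recip p - recip q)
      * (1 + Real.log ((j + 1 : ℕ) : ℝ)) ^ α) * seqRearr c (j + 1)) q Measure.count

/-- The Lorentz–Zygmund sequence space `l_{p,q}(log l)_α`. -/
def lzSeq (ι : Type*) (p q : ℝ≥0∞) (α : ℝ) : Set (ι → ℂ) :=
  {c | lzSeqNorm p q α c < ∞}

/-- The (quasi-)norm of the function space `L^𝓛_{p,q,α,r}`: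
`‖ t^{-1/q} (1 + |log t|)^α ‖ u^{1/p-1/r} f^*(u) | L_r(0,t) ‖ | L_q(0,1) ‖`. -/
def leftNorm (p q : ℝ≥0∞) (α : ℝ) (r : ℝ≥0∞) (f : ℝ → ℂ) : ℝ≥0∞ :=
  eLpNorm (fun t : ℝ =>
    ENNReal.ofReal (t ^ (-recip q) * (1 + |Real.log t|) ^ α)
      * eLpNorm (fun u : ℝ => ENNReal.ofReal (u ^ (recip p - recip r)) * fnRearr f u) r
          (volume.restrict (Ioo 0 t))) q (volume.restrict (Ioo 0 1))

/-- The function space `L^𝓛_{p,q,α,r}` on `[0,1]`. -/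
def leftSpace (p q : ℝ≥0∞) (α : ℝ) (r : ℝ≥0∞) : Set (ℝ → ℂ) :=
  {f | AEStronglyMeasurable f unitVol ∧ leftNorm p q α r f < ∞}

/-- The map `𝓕⁻¹ : c ↦ ∑ c_n φ_n`; the series is (unconditionally) summed in `L_2(0,1)`. -/
def fourierInv {ι : Type*} (φ : ι → Lp ℂ 2 unitVol) (c : ι → ℂ) : Lp ℂ 2 unitVol :=
  ∑' n, c n • φ n

end

/-!
Fix `m` with `M ≤ 2^m` and put `b_j = 2^j c^*_{4^j}`. At `t = 4^{-j}` split the series at the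
`4^i`-th largest coefficient, where `i = j - m`. The head is bounded pointwise by
`M ∑ |c_n| ≤ 4 · 2^m ∑_{l < i} 2^l b_l`, which contributes `4 ∑_{l < i} 2^{l - i} b_l` to
`‖f^*‖_{L_2(0,t)}`; by Parseval, the tail contributes `2 (∑_{l ≥ i} b_l²)^{1/2}`. With the `L_q`
norm discretised at the points `4^{-j}`, Hardy's inequalities bound the weighted `l_q` norm of these
two sequences by that of `b`. The shift by `m ∼ log M` costs a factor `(m + 1)^{|α| + 1/q}`, which
up to a constant is at most `M` and at most `(1 + log M)^{|α| + 1/q}`: no `ε` is lost.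
-/

open Filter Function
open scoped NNReal

/-! ### Tools for `eLpNorm` -/

lemma recip_eq (q : ℝ≥0∞) : recip q = 1 / q.toReal := by
  rw [recip, ENNReal.toReal_inv, one_div]

lemma recip_nonneg (q : ℝ≥0∞) : 0 ≤ recip q := ENNReal.toReal_nonneg

lemma rpow_le_rpow_abs_mul {x y K : ℝ≥0∞} (hK₀ : K ≠ 0) (hK : K ≠ ∞) (hxy : x ≤ K * y)
    (hyx : y ≤ K * x) (a : ℝ) : x ^ a ≤ K ^ |a| * y ^ a := by
  rcases le_total 0 a with ha | ha
  · rw [abs_of_nonneg ha, ← ENNReal.mul_rpow_of_nonneg _ _ ha]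
    exact ENNReal.rpow_le_rpow hxy ha
  · have hinv : x⁻¹ ≤ K * y⁻¹ := by
      rw [← inv_inv K, ← ENNReal.mul_inv (by simp [hK]) (by simp [hK₀])]
      refine ENNReal.inv_le_inv.2 ?_
      rwa [mul_comm, ← div_eq_mul_inv, ENNReal.div_le_iff' hK₀ hK]
    have hpow := ENNReal.rpow_le_rpow hinv (neg_nonneg.2 ha)
    rwa [ENNReal.mul_rpow_of_nonneg _ _ (neg_nonneg.2 ha), ENNReal.inv_rpow, ENNReal.inv_rpow,
      ← ENNReal.rpow_neg, ← ENNReal.rpow_neg, neg_neg, ← abs_of_nonpos ha] at hpow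

section eLpNorm

variable {X : Type*} [MeasurableSpace X] {μ : Measure X} {q : ℝ≥0∞}

lemma eLpNorm_rpow_toReal (hq : q ≠ 0) (hq' : q ≠ ∞) (f : X → ℝ≥0∞) :
    eLpNorm f q μ ^ q.toReal = ∫⁻ x, f x ^ q.toReal ∂μ := by
  rw [eLpNorm_eq_lintegral_rpow_enorm_toReal hq hq', one_div,
    ENNReal.rpow_inv_rpow (ENNReal.toReal_pos hq hq').ne']
  rfl

lemma eLpNorm_count_rpow_toReal {ι : Type*} [MeasurableSpace ι] [MeasurableSingletonClass ι]
    (hq : q ≠ 0) (hq' : q ≠ ∞) (x : ι → ℝ≥0∞) :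
    eLpNorm x q Measure.count ^ q.toReal = ∑' i, x i ^ q.toReal := by
  rw [eLpNorm_rpow_toReal hq hq', lintegral_count]

lemma eLpNorm_count_top {ι : Type*} [MeasurableSpace ι] [MeasurableSingletonClass ι]
    (x : ι → ℝ≥0∞) : eLpNorm x ∞ Measure.count = ⨆ i, x i := by
  rw [eLpNorm_exponent_top, eLpNormEssSup_eq_iSup (by simp)]
  rfl

lemma eLpNorm_le_iff_rpow_toReal_le (hq : q ≠ 0) (hq' : q ≠ ∞) {f : X → ℝ≥0∞} {a : ℝ≥0∞} :
    eLpNorm f q μ ≤ a ↔ ∫⁻ x, f x ^ q.toReal ∂μ ≤ a ^ q.toReal := by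
  rw [← eLpNorm_rpow_toReal hq hq', ENNReal.rpow_le_rpow_iff (ENNReal.toReal_pos hq hq')]

lemma eLpNorm_le_of_ae_le_const (hq : q ≠ 0) {f : X → ℝ≥0∞} {z : ℝ≥0∞}
    (h : ∀ᵐ x ∂μ, f x ≤ z) : eLpNorm f q μ ≤ μ univ ^ recip q * z := by
  rcases eq_or_ne μ 0 with rfl | hμ
  · simp
  · refine (eLpNorm_mono_enorm_ae (g := fun _ => z) h).trans_eq ?_
    rw [eLpNorm_const _ hq hμ, recip_eq, mul_comm, enorm_eq_self]

lemma rpow_mul_le_eLpNorm_of_ae_const_le (hq : q ≠ 0) (hμ : μ ≠ 0) {f : X → ℝ≥0∞} {z : ℝ≥0∞}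
    (h : ∀ᵐ x ∂μ, z ≤ f x) : μ univ ^ recip q * z ≤ eLpNorm f q μ := by
  refine Eq.trans_le ?_ (eLpNorm_mono_enorm_ae (f := fun _ => z) h)
  rw [eLpNorm_const _ hq hμ, recip_eq, mul_comm, enorm_eq_self]

lemma eLpNorm_count_eLpNorm_fiber {κ : Type*} [Countable κ] [MeasurableSpace κ]
    [MeasurableSingletonClass κ] {g : X → κ} (hg : Measurable g) (hq : q ≠ 0) (f : X → ℝ≥0∞) :
    eLpNorm (fun k => eLpNorm f q (μ.restrict (g ⁻¹' {k}))) q Measure.count = eLpNorm f q μ := by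
  have hcover : ⋃ k, g ⁻¹' {k} = univ := by
    rw [← preimage_iUnion, iUnion_of_singleton, preimage_univ]
  rcases eq_or_ne q ∞ with rfl | hq'
  · rw [eLpNorm_count_top]
    refine le_antisymm (iSup_le fun k => eLpNorm_mono_measure f Measure.restrict_le_self) ?_
    have hae := (ae_restrict_iUnion_iff (μ := μ) (fun k => g ⁻¹' {k})
      fun x => ‖f x‖ₑ ≤ ⨆ k, eLpNorm f ∞ (μ.restrict (g ⁻¹' {k}))).2 fun k =>
        (ae_le_eLpNormEssSup (f := f)).mono fun x hx => hx.trans <|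
          le_iSup (fun k => eLpNorm f ∞ (μ.restrict (g ⁻¹' {k}))) k
    rw [hcover, Measure.restrict_univ] at hae
    exact essSup_le_of_ae_le _ hae
  · refine ENNReal.rpow_left_injective (ENNReal.toReal_pos hq hq').ne' ?_
    simp only [eLpNorm_count_rpow_toReal hq hq', eLpNorm_rpow_toReal hq hq']
    rw [← lintegral_iUnion (fun k => hg (measurableSet_singleton k))
      (fun i j hij => (disjoint_singleton.2 hij).preimage g), hcover, Measure.restrict_univ]

lemma eLpNorm_comp_le {κ : Type*} [Countable κ] [MeasurableSpace κ] [MeasurableSingletonClass κ]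
    {g : X → κ} (hg : Measurable g) (hq : q ≠ 0) {K : ℝ≥0} (hK : ∀ k, μ (g ⁻¹' {k}) ≤ K)
    (z : κ → ℝ≥0∞) :
    eLpNorm (fun x => z (g x)) q μ ≤ (K : ℝ≥0∞) ^ recip q * eLpNorm z q Measure.count := by
  rw [← eLpNorm_count_eLpNorm_fiber hg hq, ← ENNReal.coe_rpow_of_nonneg _ (recip_nonneg q)]
  refine eLpNorm_le_mul_eLpNorm_of_ae_le_mul' (.of_forall fun k => ?_) q
  refine (eLpNorm_le_of_ae_le_const (z := z k) hq ?_).trans ?_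
  · filter_upwards [ae_restrict_mem (hg (measurableSet_singleton k))] with x hx
    rw [mem_preimage.1 hx]
  · rw [Measure.restrict_apply_univ, ENNReal.coe_rpow_of_nonneg _ (recip_nonneg q)]
    exact mul_le_mul_left (ENNReal.rpow_le_rpow (hK k) (recip_nonneg q)) _

lemma le_eLpNorm_count {ι : Type*} [MeasurableSpace ι] [MeasurableSingletonClass ι]
    (hq : q ≠ 0) (x : ι → ℝ≥0∞) (i : ι) : x i ≤ eLpNorm x q Measure.count := by
  rcases eq_or_ne q ∞ with rfl | hq'
  · exact (le_iSup x i).trans_eq (eLpNorm_count_top x).symm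
  · rw [← ENNReal.rpow_le_rpow_iff (ENNReal.toReal_pos hq hq'), eLpNorm_count_rpow_toReal hq hq']
    exact ENNReal.le_tsum (f := fun i => x i ^ q.toReal) i

lemma eLpNorm_count_anti {ι : Type*} [MeasurableSpace ι] [MeasurableSingletonClass ι]
    {s : ℝ≥0∞} (hq : q ≠ 0) (hqs : q ≤ s) (x : ι → ℝ≥0∞) :
    eLpNorm x s Measure.count ≤ eLpNorm x q Measure.count := by
  rcases eq_or_ne s ∞ with rfl | hs'
  · exact (eLpNorm_count_top x).trans_le (iSup_le (le_eLpNorm_count hq x))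
  · have hq' : q ≠ ∞ := ne_top_of_le_ne_top hs' hqs
    have hs : s ≠ 0 := fun h => hq (le_zero_iff.1 (hqs.trans_eq h))
    have hsq : 0 ≤ s.toReal - q.toReal := sub_nonneg.2 (ENNReal.toReal_mono hs' hqs)
    have split (y : ℝ≥0∞) : y ^ s.toReal = y ^ q.toReal * y ^ (s.toReal - q.toReal) := by
      rw [← ENNReal.rpow_add_of_nonneg _ _ ENNReal.toReal_nonneg hsq, add_sub_cancel]
    rw [← ENNReal.rpow_le_rpow_iff (ENNReal.toReal_pos hs hs'), eLpNorm_count_rpow_toReal hs hs',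
      split, eLpNorm_count_rpow_toReal hq hq', ← ENNReal.tsum_mul_right]
    refine ENNReal.tsum_le_tsum fun i => (split (x i)).trans_le ?_
    gcongr
    exact le_eLpNorm_count hq x i

lemma eLpNorm_iSup_le (hq : q ≠ 0) {y : ℕ → X → ℝ≥0∞} (hy : ∀ d, AEMeasurable (y d) μ) :
    eLpNorm (fun x => ⨆ d, y d x) q μ ≤ eLpNorm (fun d => eLpNorm (y d) q μ) q Measure.count := by
  rcases eq_or_ne q ∞ with rfl | hq'
  · rw [eLpNorm_count_top]
    refine essSup_le_of_ae_le _ ?_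
    filter_upwards [ae_all_iff.2 fun d => ae_le_eLpNormEssSup (f := y d) (μ := μ)] with x hx
    exact iSup_mono hx
  · rw [eLpNorm_le_iff_rpow_toReal_le hq hq', eLpNorm_count_rpow_toReal hq hq']
    simp only [eLpNorm_rpow_toReal hq hq']
    rw [← lintegral_tsum fun d => (hy d).pow_const _]
    refine lintegral_mono fun x => ?_
    rw [← ENNReal.rpow_le_rpow_iff (inv_pos.2 (ENNReal.toReal_pos hq hq')),
      ENNReal.rpow_rpow_inv (ENNReal.toReal_pos hq hq').ne']
    refine iSup_le fun d => ?_
    rw [ENNReal.le_rpow_inv_iff (ENNReal.toReal_pos hq hq')]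
    exact ENNReal.le_tsum (f := fun d => y d x ^ q.toReal) d

lemma eLpNorm_count_geometric_ne_top (hq : q ≠ 0) {σ : ℝ≥0∞} (hσ : σ < 1) :
    eLpNorm (fun d : ℕ => σ ^ d) q Measure.count ≠ ∞ := by
  rcases eq_or_ne q ∞ with rfl | hq'
  · rw [eLpNorm_count_top]
    exact ne_top_of_le_ne_top ENNReal.one_ne_top (iSup_le fun d => pow_le_one' hσ.le d)
  · have hq₀ := ENNReal.toReal_pos hq hq'
    rw [← lt_top_iff_ne_top, ← ENNReal.rpow_lt_top_iff_of_pos hq₀, eLpNorm_count_rpow_toReal hq hq']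
    simp only [← ENNReal.rpow_natCast_mul, mul_comm _ q.toReal]
    simp only [ENNReal.rpow_mul, ENNReal.rpow_natCast, ENNReal.tsum_geometric]
    exact ENNReal.inv_lt_top.2 (tsub_pos_of_lt (ENNReal.rpow_lt_one hσ hq₀))

/-- A substitute for the triangle inequality that is also available for `q < 1`. With `τ = σ²`, one
factor `σ^d` makes the sum of the `y d` comparable to a supremum, the other one makes the `l_q` norm
over `d` converge. -/
lemma eLpNorm_tsum_geometric_le (hq : q ≠ 0) {τ : ℝ≥0∞} (hτ : τ < 1) :
    ∃ C : ℝ≥0, ∀ (y : ℕ → X → ℝ≥0∞) (K : ℝ≥0∞), (∀ d, AEMeasurable (y d) μ) →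
      (∀ d, eLpNorm (y d) q μ ≤ K) → eLpNorm (fun x => ∑' d, τ ^ d * y d x) q μ ≤ C * K := by
  obtain ⟨σ, hσ, rfl⟩ : ∃ σ < 1, σ ^ 2 = τ :=
    ⟨τ ^ (1 / 2 : ℝ), ENNReal.rpow_lt_one hτ (by norm_num), by
      rw [← ENNReal.rpow_mul_natCast]; norm_num⟩
  lift σ to ℝ≥0 using hσ.ne_top
  have hsum : ∑' d, (σ : ℝ≥0∞) ^ d ≠ ∞ := by
    simpa [ENNReal.tsum_geometric, tsub_eq_zero_iff_le] using hσ
  lift ∑' d, (σ : ℝ≥0∞) ^ d to ℝ≥0 using hsum with S hS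
  lift eLpNorm (fun d : ℕ => (σ : ℝ≥0∞) ^ d) q Measure.count to ℝ≥0
    using eLpNorm_count_geometric_ne_top hq hσ with N hN
  refine ⟨S * N, fun y K hy hK => ?_⟩
  calc eLpNorm (fun x => ∑' d, ((σ : ℝ≥0∞) ^ 2) ^ d * y d x) q μ
      ≤ S * eLpNorm (fun x => ⨆ d, (σ : ℝ≥0∞) ^ d * y d x) q μ := by
        refine eLpNorm_le_mul_eLpNorm_of_ae_le_mul' (.of_forall fun x => ?_) q
        simp only [enorm_eq_self, hS, ← ENNReal.tsum_mul_right]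
        refine ENNReal.tsum_le_tsum fun d => ?_
        rw [pow_right_comm, sq, mul_assoc]
        gcongr
        exact le_iSup (fun d => (σ : ℝ≥0∞) ^ d * y d x) d
    _ ≤ S * eLpNorm (fun d => eLpNorm (fun x => (σ : ℝ≥0∞) ^ d * y d x) q μ) q Measure.count := by
        gcongr
        exact eLpNorm_iSup_le hq fun d => (hy d).const_mul _
    _ ≤ S * (K * eLpNorm (fun d : ℕ => (σ : ℝ≥0∞) ^ d) q Measure.count) := by
        gcongr
        refine eLpNorm_le_mul_eLpNorm_of_ae_le_mul'' q (by fun_prop) (.of_forall fun d => ?_)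
        rw [enorm_eq_self, enorm_eq_self, mul_comm K]
        refine (eLpNorm_le_mul_eLpNorm_of_ae_le_mul' (c := σ ^ d) (g := y d)
          (.of_forall fun x => by simp) q).trans ?_
        push_cast
        gcongr
        exact hK d
    _ = (S * N : ℝ≥0) * K := by rw [← hN]; push_cast; ring

end eLpNorm

/-! ### Weighted Hardy inequalities for sequences -/

/-- The power weight `(j + 1)^a` on `ℕ`; the shift keeps it away from `0^a` at `j = 0`. Since `j` is
a logarithmic scale below, these are the logarithmic weights of the function spaces. -/
noncomputable def powWeight (a : ℝ) (j : ℕ) : ℝ≥0∞ := ((j : ℝ≥0∞) + 1) ^ a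

lemma powWeight_le_mul_of_le_add (a : ℝ) {i j d : ℕ} (hij : i ≤ j) (hji : j ≤ i + d) :
    powWeight a j ≤ powWeight |a| d * powWeight a i := by
  refine rpow_le_rpow_abs_mul (by simp) (by simp) ?_ ?_ a
  · exact_mod_cast (by nlinarith : j + 1 ≤ (d + 1) * (i + 1))
  · exact_mod_cast (by nlinarith : i + 1 ≤ (d + 1) * (j + 1))

lemma powWeight_neg_mul_self (a : ℝ) (j : ℕ) : powWeight (-a) j * powWeight a j = 1 := by
  rw [powWeight, powWeight, ← ENNReal.rpow_add _ _ (by simp) (by finiteness), neg_add_cancel,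
    ENNReal.rpow_zero]

lemma exists_powWeight_le_pow {a : ℝ} (ha : 0 ≤ a) {x : ℝ≥0∞} (hx : 1 < x) :
    ∃ C : ℝ≥0, ∀ d, powWeight a d ≤ C * x ^ d := by
  obtain ⟨δ, hδ, hx'⟩ : ∃ δ : ℝ≥0, δ ≠ 0 ∧ (1 + δ : ℝ≥0∞) ^ a ≤ x := by
    have hlim : Tendsto (fun δ : ℝ≥0 => (1 + δ : ℝ≥0∞) ^ a) (nhdsWithin 0 {0}ᶜ) (nhds 1) := by
      refine tendsto_nhdsWithin_of_tendsto_nhds ?_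
      have hcont : Continuous fun δ : ℝ≥0 => (1 + δ : ℝ≥0∞) ^ a := by fun_prop
      simpa using hcont.tendsto 0
    exact (eventually_mem_nhdsWithin.and (hlim.eventually_le_const hx)).exists
  refine ⟨(1 + δ⁻¹) ^ a, fun d => ?_⟩
  have bernoulli : (d : ℝ≥0) + 1 ≤ (1 + δ⁻¹) * (1 + δ) ^ d := calc
    (d : ℝ≥0) + 1 ≤ (1 + δ⁻¹) * (1 + d * δ) := by
      have expand : (1 + δ⁻¹) * (1 + d * δ) = (d + 1) + (δ⁻¹ + d * δ) := by field_simp; ring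
      exact expand ▸ le_self_add
    _ ≤ (1 + δ⁻¹) * (1 + δ) ^ d := by
      gcongr
      exact one_add_mul_le_pow_of_sq_nonneg zero_le zero_le zero_le d
  calc powWeight a d ≤ ((1 + δ⁻¹ : ℝ≥0) * (1 + δ : ℝ≥0∞) ^ d) ^ a :=
        ENNReal.rpow_le_rpow (by exact_mod_cast bernoulli) ha
    _ = ((1 + δ⁻¹) ^ a : ℝ≥0) * ((1 + δ : ℝ≥0∞) ^ a) ^ d := by
        rw [ENNReal.mul_rpow_of_nonneg _ _ ha, ENNReal.coe_rpow_of_nonneg _ ha,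
          ← ENNReal.rpow_natCast, ← ENNReal.rpow_natCast, ← ENNReal.rpow_mul, ← ENNReal.rpow_mul,
          mul_comm a]
    _ ≤ _ := by gcongr

section Hardy

variable {q : ℝ≥0∞}

lemma exists_eLpNorm_powWeight_mul_sum_geometric_le (hq : q ≠ 0) (α : ℝ) {τ : ℝ≥0∞} (hτ : τ < 1) :
    ∃ C : ℝ≥0, ∀ b : ℕ → ℝ≥0∞,
      eLpNorm (fun j => powWeight α j * ∑ l ∈ Finset.range (j + 1), τ ^ (j - l) * b l) q
        Measure.count ≤ C * eLpNorm (fun j => powWeight α j * b j) q Measure.count := by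
  obtain ⟨x, hx, hxτ⟩ := exists_between (ENNReal.one_lt_inv.2 hτ)
  obtain ⟨C₁, hC₁⟩ := exists_powWeight_le_pow (abs_nonneg α) hx
  obtain ⟨C₂, hC₂⟩ := eLpNorm_tsum_geometric_le (μ := (Measure.count : Measure ℕ)) hq
    (ENNReal.mul_lt_of_lt_div' (by simpa using hxτ) : τ * x < 1)
  refine ⟨C₁ * C₂, fun b => ?_⟩
  set z : ℕ → ℝ≥0∞ := fun j => powWeight α j * b j
  have hz (d : ℕ) : eLpNorm ((Ici d).indicator fun j => z (j - d)) q Measure.count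
      ≤ eLpNorm z q Measure.count := by
    rw [eLpNorm_indicator_eq_eLpNorm_restrict measurableSet_Ici]
    refine (eLpNorm_comp_le (K := 1) (measurable_of_countable _) hq (fun k => ?_) z).trans_eq
      (by simp)
    rw [Measure.restrict_apply (.of_discrete)]
    refine (measure_mono (t := {k + d}) ?_).trans_eq (by simp)
    rintro j ⟨hjk : j - d = k, hdj : d ≤ j⟩
    exact (tsub_eq_iff_eq_add_of_le hdj).1 hjk
  calc _ ≤ C₁ * eLpNorm (fun j => ∑' d, (τ * x) ^ d * (Ici d).indicator (fun j => z (j - d)) j) q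
          Measure.count := by
        refine eLpNorm_le_mul_eLpNorm_of_ae_le_mul' (.of_forall fun j => ?_) q
        rw [enorm_eq_self, enorm_eq_self, ← Finset.sum_flip, Finset.mul_sum]
        refine le_trans ?_ (mul_le_mul_right (ENNReal.sum_le_tsum (Finset.range (j + 1))) _)
        rw [Finset.mul_sum]
        refine Finset.sum_le_sum fun d hd => ?_
        have hdj : d ≤ j := Nat.lt_succ_iff.1 (Finset.mem_range.1 hd)
        rw [indicator_of_mem (mem_Ici.2 hdj), Nat.sub_sub_self hdj, mul_pow]
        calc powWeight α j * (τ ^ d * b (j - d))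
            ≤ C₁ * x ^ d * powWeight α (j - d) * (τ ^ d * b (j - d)) := by
              gcongr
              exact (powWeight_le_mul_of_le_add α (Nat.sub_le j d) (by omega)).trans
                (mul_le_mul_left (hC₁ d) _)
          _ = C₁ * (τ ^ d * x ^ d * z (j - d)) := by ring
    _ ≤ C₁ * (C₂ * eLpNorm z q Measure.count) := by
        gcongr
        exact hC₂ _ _ (fun d => (measurable_of_countable _).aemeasurable) hz
    _ = _ := by push_cast; ring

/-- The `k`-th dyadic block `{2^k - 1, …, 2^(k+1) - 2}` of `ℕ`, on which `i + 1` is comparable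
to `2^k`. -/
def dyadicBlock (k : ℕ) : Set ℕ := (fun i => Nat.log 2 (i + 1)) ⁻¹' {k}

lemma mem_dyadicBlock_iff {i k : ℕ} :
    i ∈ dyadicBlock k ↔ 2 ^ k ≤ i + 1 ∧ i + 1 < 2 ^ (k + 1) := by
  rw [dyadicBlock, mem_preimage, mem_singleton_iff, Nat.log_eq_iff (by simp)]

lemma count_dyadicBlock_le (k : ℕ) : Measure.count (dyadicBlock k) ≤ 2 ^ k := by
  have hsub : dyadicBlock k ⊆ Finset.Ico (2 ^ k - 1) (2 ^ (k + 1) - 1) := fun i hi => by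
    rw [mem_dyadicBlock_iff] at hi
    simp only [Finset.coe_Ico, mem_Ico]
    omega
  refine (measure_mono hsub).trans ?_
  rw [Measure.count_apply_finset, Nat.card_Ico]
  exact_mod_cast (by have := Nat.one_le_two_pow (n := k); omega :
    2 ^ (k + 1) - 1 - (2 ^ k - 1) ≤ 2 ^ k)

lemma powWeight_le_of_mem_dyadicBlock (a : ℝ) {i k : ℕ} (hi : i ∈ dyadicBlock k) :
    powWeight a i ≤ 2 ^ |a| * (2 ^ k) ^ a := by
  rw [mem_dyadicBlock_iff] at hi
  refine rpow_le_rpow_abs_mul (by simp) (by simp) ?_ ?_ a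
  · exact_mod_cast (by omega : i + 1 ≤ 2 * 2 ^ k)
  · exact_mod_cast (by omega : 2 ^ k ≤ 2 * (i + 1))

lemma eLpNorm_restrict_Ici_le_tsum_dyadicBlock {s : ℝ≥0∞} (hs : 1 ≤ s) (b : ℕ → ℝ≥0∞) {i k : ℕ}
    (hi : i ∈ dyadicBlock k) :
    eLpNorm b s (Measure.count.restrict (Ici i))
      ≤ ∑' d, eLpNorm b s (Measure.count.restrict (dyadicBlock (k + d))) := by
  have hs₀ : s ≠ 0 := (zero_lt_one.trans_le hs).ne'
  rw [← eLpNorm_count_eLpNorm_fiber (measurable_of_countable fun l => Nat.log 2 (l + 1) - k) hs₀]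
  refine (eLpNorm_count_anti one_ne_zero hs _).trans ?_
  rw [eLpNorm_one_eq_lintegral_enorm, lintegral_count]
  refine ENNReal.tsum_le_tsum fun d => eLpNorm_mono_measure b ?_
  rw [Measure.restrict_restrict .of_discrete]
  refine Measure.restrict_mono_set _ fun l hl => ?_
  have hkl : k ≤ Nat.log 2 (l + 1) := hi ▸ Nat.log_mono_right (Nat.succ_le_succ hl.2)
  have hld : Nat.log 2 (l + 1) - k = d := hl.1
  simp only [dyadicBlock, mem_preimage, mem_singleton_iff]
  omega

lemma eLpNorm_restrict_count_le {ι : Type*} [MeasurableSpace ι] [MeasurableSingletonClass ι]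
    [Countable ι] {D : Set ι} {K : ℝ≥0∞} (hK : Measure.count D ≤ K) (hq : q ≠ 0) (s : ℝ≥0∞)
    (b : ι → ℝ≥0∞) :
    eLpNorm b s (Measure.count.restrict D)
      ≤ K ^ (recip (min q s) - recip q) * eLpNorm b q (Measure.count.restrict D) := by
  rcases le_total q s with hqs | hsq
  · rw [min_eq_left hqs, sub_self, ENNReal.rpow_zero, one_mul,
      ← eLpNorm_indicator_eq_eLpNorm_restrict .of_discrete,
      ← eLpNorm_indicator_eq_eLpNorm_restrict .of_discrete]
    exact eLpNorm_count_anti hq hqs _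
  · rcases eq_or_ne s 0 with rfl | hs
    · simp
    rw [min_eq_right hsq, mul_comm, recip_eq, recip_eq]
    refine (eLpNorm_le_eLpNorm_mul_rpow_measure_univ hsq
      (measurable_of_countable b).aestronglyMeasurable).trans ?_
    rw [Measure.restrict_apply_univ]
    gcongr
    rcases eq_or_ne q ∞ with rfl | hq'
    · simp
    · exact sub_nonneg.2 <| one_div_le_one_div_of_le
        (ENNReal.toReal_pos hs (ne_top_of_le_ne_top hq' hsq)) (ENNReal.toReal_mono hq' hsq)

lemma exists_eLpNorm_two_pow_mul_tsum_add_le (hq : q ≠ 0) {γ : ℝ} (hγ : 0 < γ) :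
    ∃ C : ℝ≥0, ∀ B : ℕ → ℝ≥0∞,
      eLpNorm (fun k => (2 ^ k) ^ γ * ∑' d, B (k + d)) q Measure.count
        ≤ C * eLpNorm (fun k => (2 ^ k) ^ γ * B k) q Measure.count := by
  have hτ : (2 : ℝ≥0∞) ^ (-γ) < 1 := ENNReal.rpow_lt_one_of_one_lt_of_neg (by norm_num) (by simpa)
  obtain ⟨C, hC⟩ := eLpNorm_tsum_geometric_le (μ := (Measure.count : Measure ℕ)) hq hτ
  refine ⟨C, fun B => ?_⟩
  set z : ℕ → ℝ≥0∞ := fun k => (2 ^ k) ^ γ * B k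
  have hrescale (k d : ℕ) :
      (2 ^ k : ℝ≥0∞) ^ γ * B (k + d) = (2 ^ (-γ)) ^ d * z (k + d) := by
    rw [← mul_assoc]
    congr 1
    simp only [← ENNReal.rpow_natCast, ← ENNReal.rpow_mul]
    rw [← ENNReal.rpow_add _ _ (by simp) (by simp)]
    congr 1
    push_cast
    ring
  have hshift (d : ℕ) : eLpNorm (fun k => z (k + d)) q Measure.count
      ≤ eLpNorm z q Measure.count := by
    refine (eLpNorm_comp_le (K := 1) (measurable_of_countable (· + d)) hq (fun l => ?_) z).trans_eq
      (by simp)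
    refine (measure_mono (t := {l - d}) fun k (hk : k + d = l) => ?_).trans_eq (by simp)
    rw [mem_singleton_iff]
    omega
  simp only [← ENNReal.tsum_mul_left, hrescale]
  exact hC _ _ (fun d => (measurable_of_countable _).aemeasurable) hshift

lemma two_pow_rpow_add (k : ℕ) (x y : ℝ) :
    (2 ^ k : ℝ≥0∞) ^ (x + y) = (2 ^ k) ^ x * (2 ^ k) ^ y :=
  ENNReal.rpow_add _ _ (by simp) (by simp)

lemma eLpNorm_powWeight_mul_eLpNorm_Ici_le_dyadic (hq : q ≠ 0) {s : ℝ≥0∞} (hs : 1 ≤ s) (α : ℝ)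
    (b : ℕ → ℝ≥0∞) :
    eLpNorm (fun i => powWeight α i * eLpNorm b s (Measure.count.restrict (Ici i))) q Measure.count
      ≤ 2 ^ |α| * eLpNorm (fun k => (2 ^ k) ^ (α + recip q) *
          ∑' d, eLpNorm b s (Measure.count.restrict (dyadicBlock (k + d)))) q Measure.count := by
  rw [← eLpNorm_count_eLpNorm_fiber (measurable_of_countable fun i => Nat.log 2 (i + 1)) hq]
  refine eLpNorm_le_mul_eLpNorm_of_ae_le_mul'' q
    (measurable_of_countable _).aestronglyMeasurable (.of_forall fun k => ?_)
  set B := ∑' d, eLpNorm b s (Measure.count.restrict (dyadicBlock (k + d)))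
  refine (eLpNorm_le_of_ae_le_const hq (z := 2 ^ |α| * (2 ^ k) ^ α * B) ?_).trans ?_
  · filter_upwards [ae_restrict_mem .of_discrete] with i hi
    exact mul_le_mul' (powWeight_le_of_mem_dyadicBlock α hi)
      (eLpNorm_restrict_Ici_le_tsum_dyadicBlock hs b hi)
  · rw [Measure.restrict_apply_univ, enorm_eq_self, two_pow_rpow_add]
    calc _ ≤ (2 ^ k) ^ recip q * (2 ^ |α| * (2 ^ k) ^ α * B) := by
          gcongr
          exacts [recip_nonneg q, count_dyadicBlock_le k]
      _ = _ := by ring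

lemma eLpNorm_two_pow_mul_eLpNorm_dyadicBlock_le (hq : q ≠ 0) (s : ℝ≥0∞) (α : ℝ) (b : ℕ → ℝ≥0∞) :
    eLpNorm (fun k => (2 ^ k) ^ (α + recip q) *
        eLpNorm b s (Measure.count.restrict (dyadicBlock k))) q Measure.count
      ≤ 2 ^ |α + recip (min q s)| *
        eLpNorm (fun i => powWeight (α + recip (min q s)) i * b i) q Measure.count := by
  set β := α + recip (min q s) with hβ
  rw [← eLpNorm_count_eLpNorm_fiber (measurable_of_countable fun i => Nat.log 2 (i + 1)) hq
    fun i => powWeight β i * b i]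
  refine eLpNorm_le_mul_eLpNorm_of_ae_le_mul'' q
    (measurable_of_countable _).aestronglyMeasurable (.of_forall fun k => ?_)
  have hb : eLpNorm b q (Measure.count.restrict (dyadicBlock k)) ≤ 2 ^ |β| * (2 ^ k) ^ (-β) *
      eLpNorm (fun i => powWeight β i * b i) q (Measure.count.restrict (dyadicBlock k)) := by
    refine eLpNorm_le_mul_eLpNorm_of_ae_le_mul'' q
      (measurable_of_countable _).aestronglyMeasurable ?_
    filter_upwards [ae_restrict_mem .of_discrete] with i hi
    rw [enorm_eq_self, enorm_eq_self, ← mul_assoc]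
    refine le_mul_of_one_le_left zero_le ?_
    rw [← powWeight_neg_mul_self β i, ← abs_neg β]
    gcongr
    exact powWeight_le_of_mem_dyadicBlock (-β) hi
  rw [enorm_eq_self, enorm_eq_self]
  calc (2 ^ k) ^ (α + recip q) * eLpNorm b s (Measure.count.restrict (dyadicBlock k))
      ≤ (2 ^ k) ^ (α + recip q) * ((2 ^ k) ^ (recip (min q s) - recip q) *
          (2 ^ |β| * (2 ^ k) ^ (-β) * eLpNorm (fun i => powWeight β i * b i) q
            (Measure.count.restrict (dyadicBlock k)))) := by
        gcongr
        exact (eLpNorm_restrict_count_le (count_dyadicBlock_le k) hq s b).trans (by gcongr)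
    _ = (2 ^ k) ^ (α + recip q + (recip (min q s) - recip q) + -β) * (2 ^ |β| *
          eLpNorm (fun i => powWeight β i * b i) q (Measure.count.restrict (dyadicBlock k))) := by
        rw [two_pow_rpow_add k (_ + _), two_pow_rpow_add k (_ + recip q)]; ring
    _ = _ := by
        rw [show α + recip q + (recip (min q s) - recip q) + -β = 0 by rw [hβ]; ring,
          ENNReal.rpow_zero, one_mul]
        rfl

/-- Hardy's inequality for tails. On dyadic blocks the power weights become exponential, so the sum
over the blocks is geometric; the inner exponent `s` only matters inside a block. -/
lemma exists_eLpNorm_powWeight_mul_eLpNorm_Ici_le (hq : q ≠ 0) {s : ℝ≥0∞} (hs : 1 ≤ s) {α : ℝ}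
    (hα : -recip q < α) :
    ∃ C : ℝ≥0, ∀ b : ℕ → ℝ≥0∞,
      eLpNorm (fun i => powWeight α i * eLpNorm b s (Measure.count.restrict (Ici i))) q
        Measure.count
        ≤ C * eLpNorm (fun i => powWeight (α + recip (min q s)) i * b i) q Measure.count := by
  obtain ⟨C, hC⟩ := exists_eLpNorm_two_pow_mul_tsum_add_le hq (by linarith : 0 < α + recip q)
  lift (2 : ℝ≥0∞) ^ |α| to ℝ≥0 using by finiteness with K₁ hK₁
  lift (2 : ℝ≥0∞) ^ |α + recip (min q s)| to ℝ≥0 using by finiteness with K₂ hK₂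
  refine ⟨K₁ * (C * K₂), fun b => ?_⟩
  have hleft := eLpNorm_powWeight_mul_eLpNorm_Ici_le_dyadic hq hs α b
  have hright := eLpNorm_two_pow_mul_eLpNorm_dyadicBlock_le hq s α b
  rw [← hK₁] at hleft
  rw [← hK₂] at hright
  have hmid := hC fun k => eLpNorm b s (Measure.count.restrict (dyadicBlock k))
  rw [ENNReal.coe_mul, ENNReal.coe_mul, mul_assoc, mul_assoc]
  exact hleft.trans (mul_le_mul_right (hmid.trans (mul_le_mul_right hright _)) _)

end Hardy

/-! ### Non-increasing rearrangements -/

lemma volume_Ioi_ofReal_lt (x : ℝ≥0∞) :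
    volume.restrict (Ioi (0 : ℝ)) {s | ENNReal.ofReal s < x} = x := by
  rw [Measure.restrict_apply (measurableSet_lt ENNReal.measurable_ofReal measurable_const)]
  rcases eq_or_ne x ∞ with rfl | hx
  · simp
  · have hIoo : {s : ℝ | ENNReal.ofReal s < x} ∩ Ioi 0 = Ioo 0 x.toReal := by
      ext s
      refine ⟨fun h => ⟨h.2, (ENNReal.ofReal_lt_iff_lt_toReal h.2.le hx).1 h.1⟩,
        fun h => ⟨(ENNReal.ofReal_lt_iff_lt_toReal h.1.le hx).2 h.2, h.1⟩⟩
    rw [hIoo, Real.volume_Ioo, sub_zero, ENNReal.ofReal_toReal hx]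

section Distribution

variable {X Y : Type*} [MeasurableSpace X] [MeasurableSpace Y] {μ : Measure X} {ν : Measure Y}

lemma lintegral_eq_lintegral_meas_ofReal_lt [SFinite μ] {F : X → ℝ≥0∞} (hF : Measurable F) :
    ∫⁻ a, F a ∂μ = ∫⁻ s in Ioi (0 : ℝ), μ {a | ENNReal.ofReal s < F a} := by
  have hmeas : MeasurableSet {p : X × ℝ | ENNReal.ofReal p.2 < F p.1} :=
    measurableSet_lt (ENNReal.measurable_ofReal.comp measurable_snd) (hF.comp measurable_fst)
  have hfubini := (Measure.prod_apply (μ := μ) (ν := volume.restrict (Ioi 0)) hmeas).symm.trans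
    (Measure.prod_apply_symm hmeas)
  simpa only [preimage_ofPred_eq, volume_Ioi_ofReal_lt] using hfubini

lemma eLpNorm_le_of_meas_lt_le [SFinite μ] [SFinite ν] {F : X → ℝ≥0∞} {H : Y → ℝ≥0∞}
    (hF : Measurable F) (hH : Measurable H) (h : ∀ s, μ {a | s < F a} ≤ ν {a | s < H a})
    (p : ℝ≥0∞) : eLpNorm F p μ ≤ eLpNorm H p ν := by
  rcases eq_or_ne p 0 with rfl | hp
  · simp
  rcases eq_or_ne p ∞ with rfl | hp'
  · simp only [eLpNorm_exponent_top, eLpNormEssSup, enorm_eq_self, essSup_eq_sInf]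
    exact sInf_le_sInf fun s hs => le_zero_iff.1 ((h s).trans_eq hs)
  · have hp₀ := ENNReal.toReal_pos hp hp'
    rw [eLpNorm_le_iff_rpow_toReal_le hp hp', eLpNorm_rpow_toReal hp hp',
      lintegral_eq_lintegral_meas_ofReal_lt (hF.pow_const _),
      lintegral_eq_lintegral_meas_ofReal_lt (hH.pow_const _)]
    refine lintegral_mono fun s => ?_
    simp only [← ENNReal.rpow_inv_lt_iff hp₀]
    exact h _

end Distribution

lemma fnRearr_antitone (f : ℝ → ℂ) : Antitone (fnRearr f) := fun _ _ huv =>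
  sInf_le_sInf fun _ hs => le_trans hs (ENNReal.ofReal_le_ofReal huv)

lemma fnRearr_le_add {f h : ℝ → ℂ} {G : ℝ≥0∞} (hae : ∀ᵐ x ∂unitVol, ‖f x‖ₑ ≤ G + ‖h x‖ₑ) (u : ℝ) :
    fnRearr f u ≤ G + fnRearr h u := by
  unfold fnRearr
  rw [ENNReal.add_sInf]
  refine le_iInf₂ fun s hs => sInf_le (le_trans (measure_mono_ae ?_) hs)
  filter_upwards [hae] with x hx (hlt : G + s < ‖f x‖ₑ)
  exact lt_of_add_lt_add_left (hlt.trans_le hx)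

lemma volume_lt_fnRearr_le (h : ℝ → ℂ) (t : ℝ) (s : ℝ≥0∞) :
    volume.restrict (Ioo 0 t) {u | s < fnRearr h u} ≤ unitVol {x | s < ‖h x‖ₑ} := by
  have hfin : unitVol {x | s < ‖h x‖ₑ} ≠ ∞ := measure_ne_top _ _
  rw [Measure.restrict_apply' measurableSet_Ioo]
  refine (measure_mono (t := Ioo 0 (unitVol {x | s < ‖h x‖ₑ}).toReal) ?_).trans_eq ?_
  · rintro u ⟨(hsu : s < fnRearr h u), hu⟩
    refine ⟨hu.1, (ENNReal.ofReal_lt_iff_lt_toReal hu.1.le hfin).1 ?_⟩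
    by_contra! hle
    exact hsu.not_ge (sInf_le hle)
  · rw [Real.volume_Ioo, sub_zero, ENNReal.ofReal_toReal hfin]

lemma eLpNorm_fnRearr_le {p : ℝ≥0∞} (hp : 1 ≤ p) {f g h : ℝ → ℂ} (hh : Measurable h)
    (hf : f =ᵐ[unitVol] g + h) (t : ℝ) :
    eLpNorm (fnRearr f) p (volume.restrict (Ioo 0 t))
      ≤ ENNReal.ofReal t ^ recip p * eLpNorm g ∞ unitVol + eLpNorm h p unitVol := by
  set G := eLpNorm g ∞ unitVol
  have hbound : ∀ᵐ x ∂unitVol, ‖f x‖ₑ ≤ G + ‖h x‖ₑ := by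
    filter_upwards [hf, ae_le_eLpNormEssSup (f := g)] with x hx hg
    rw [hx]
    exact (enorm_add_le _ _).trans (add_le_add_left hg _)
  calc eLpNorm (fnRearr f) p (volume.restrict (Ioo 0 t))
      ≤ eLpNorm ((fun _ => G) + fnRearr h) p (volume.restrict (Ioo 0 t)) :=
        eLpNorm_mono_enorm (fnRearr_le_add hbound)
    _ ≤ eLpNorm (fun _ => G) p (volume.restrict (Ioo 0 t)) +
          eLpNorm (fnRearr h) p (volume.restrict (Ioo 0 t)) :=
        eLpNorm_add_le aestronglyMeasurable_const
          (fnRearr_antitone h).measurable.aestronglyMeasurable hp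
    _ ≤ ENNReal.ofReal t ^ recip p * G + eLpNorm h p unitVol := by
        gcongr
        · refine (eLpNorm_le_of_ae_le_const (zero_lt_one.trans_le hp).ne' (.of_forall fun _ =>
            le_rfl)).trans_eq ?_
          rw [Measure.restrict_apply_univ, Real.volume_Ioo, sub_zero]
        · exact (eLpNorm_le_of_meas_lt_le (fnRearr_antitone h).measurable hh.enorm
            (volume_lt_fnRearr_le h t) p).trans_eq (eLpNorm_enorm h)

section SeqRearr

variable {ι : Type*} (c : ι → ℂ)

lemma seqRearr_antitone : Antitone (seqRearr c) := fun k _ hkl =>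
  sInf_le_sInf fun s (hs : {n | s < ‖c n‖ₑ}.encard < k) => hs.trans_le (Nat.cast_le.2 hkl)

lemma encard_lt_seqRearr {k : ℕ} (hk : k ≠ 0) : {n | seqRearr c k < ‖c n‖ₑ}.encard < k := by
  by_contra! hcard
  obtain ⟨T, hT, hTk⟩ := exists_subset_encard_eq hcard
  have hne : T.Nonempty := by
    rw [← encard_ne_zero, hTk]
    exact_mod_cast hk
  obtain ⟨m, hmT, hmin⟩ := exists_min_image T (fun n => ‖c n‖ₑ) (finite_of_encard_eq_coe hTk) hne
  have hm : seqRearr c k < ‖c m‖ₑ := hT hmT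
  obtain ⟨s, hs, hsm⟩ := sInf_lt_iff.1 hm
  have hTs : T ⊆ {n | s < ‖c n‖ₑ} := fun n hn => hsm.trans_le (hmin n hn)
  exact ((encard_le_encard hTs).trans_lt hs).ne hTk

/-- The set of indices whose coefficient exceeds the `4^j`-th largest one; it has fewer than `4^j`
elements. -/
def superlevel (j : ℕ) : Set ι := {n | seqRearr c (4 ^ j) < ‖c n‖ₑ}

lemma encard_superlevel_lt (j : ℕ) : (superlevel c j).encard < (4 ^ j : ℕ) :=
  encard_lt_seqRearr c (by positivity)

lemma finite_superlevel (j : ℕ) : (superlevel c j).Finite :=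
  encard_ne_top_iff.1 (ne_top_of_lt (encard_superlevel_lt c j))

lemma superlevel_zero : superlevel c 0 = ∅ := by
  simpa using encard_superlevel_lt c 0

lemma superlevel_mono : Monotone (superlevel c) := fun _ _ hij _ hn =>
  lt_of_le_of_lt (seqRearr_antitone c (Nat.pow_le_pow_right (by norm_num) hij)) hn

lemma exists_mem_superlevel_succ_diff {i j : ℕ} {n : ι} (hi : n ∉ superlevel c i)
    (hj : n ∈ superlevel c j) : ∃ l ∈ Ico i j, n ∈ superlevel c (l + 1) \ superlevel c l := by
  classical
  have hex : ∃ k, n ∈ superlevel c k := ⟨j, hj⟩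
  have hlt : i < Nat.find hex := by
    by_contra! hle
    exact hi (superlevel_mono c hle (Nat.find_spec hex))
  have hsucc : Nat.find hex - 1 + 1 = Nat.find hex := by omega
  refine ⟨Nat.find hex - 1, ⟨by omega, ?_⟩, ?_, Nat.find_min hex (by omega)⟩
  · have := Nat.find_min' hex hj
    omega
  · rw [hsucc]
    exact Nat.find_spec hex

lemma tsum_enorm_pow_le {p : ℕ} (hp : p ≠ 0) {T : Set ι} {L : Set ℕ}
    (h : ∀ n ∈ T, c n ≠ 0 → ∃ l ∈ L, n ∈ superlevel c (l + 1) \ superlevel c l) :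
    ∑' n : T, ‖c n‖ₑ ^ p ≤ 4 * ∑' l : L, 4 ^ (l : ℕ) * seqRearr c (4 ^ (l : ℕ)) ^ p := by
  calc ∑' n : T, ‖c n‖ₑ ^ p
      ≤ ∑' n : T, ∑' l : L,
          (superlevel c (l + 1)).indicator (fun _ => seqRearr c (4 ^ (l : ℕ)) ^ p) n.1 := by
        refine ENNReal.tsum_le_tsum fun n => ?_
        rcases eq_or_ne (c n) 0 with h₀ | h₀
        · simp [h₀, hp]
        obtain ⟨l, hl, hmem, hnotMem⟩ := h n n.2 h₀
        refine le_trans ?_ (ENNReal.le_tsum ⟨l, hl⟩)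
        rw [indicator_of_mem hmem]
        exact pow_le_pow_left' (not_lt.1 hnotMem) p
    _ = ∑' l : L, ∑' n : T,
          (superlevel c (l + 1)).indicator (fun _ => seqRearr c (4 ^ (l : ℕ)) ^ p) n.1 :=
        ENNReal.tsum_comm
    _ ≤ ∑' l : L, 4 * (4 ^ (l : ℕ) * seqRearr c (4 ^ (l : ℕ)) ^ p) := by
        refine ENNReal.tsum_le_tsum fun l => ?_
        refine (ENNReal.tsum_comp_le_tsum_of_injective Subtype.val_injective _).trans ?_
        rw [← tsum_subtype, ENNReal.tsum_set_const, ← mul_assoc, ← pow_succ']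
        gcongr
        exact_mod_cast ENat.toENNReal_mono (encard_superlevel_lt c (l + 1)).le
    _ = _ := ENNReal.tsum_mul_left

/-- The dyadic blocks `b_j = 2^j c^*_{4^j}`: `b_j²` is the contribution to `∑ |c_n|²` of the
coefficients ranked around `4^j`. -/
noncomputable def block (j : ℕ) : ℝ≥0∞ := 2 ^ j * seqRearr c (4 ^ j)

lemma tsum_superlevel_enorm_le (i : ℕ) :
    ∑' n : superlevel c i, ‖c n‖ₑ ≤ 4 * ∑ l ∈ Finset.range i, 2 ^ l * block c l := by
  have hlayers := tsum_enorm_pow_le c one_ne_zero (T := superlevel c i) (L := ↑(Finset.range i))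
    fun n hn _ => by
      have hn₀ : n ∉ superlevel c 0 := by simp [superlevel_zero]
      simpa using exists_mem_superlevel_succ_diff c hn₀ hn
  simp only [pow_one] at hlayers
  refine hlayers.trans_eq ?_
  rw [Finset.tsum_subtype' (Finset.range i) fun l => (4 : ℝ≥0∞) ^ l * seqRearr c (4 ^ l)]
  congr! 2 with l
  rw [block, ← mul_assoc, ← mul_pow]
  norm_num

lemma tsum_compl_superlevel_enorm_sq_le
    (hc : Tendsto (fun j => seqRearr c (4 ^ j)) atTop (nhds 0)) (i : ℕ) :
    ∑' n : ↥(superlevel c i)ᶜ, ‖c n‖ₑ ^ 2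
      ≤ (2 * eLpNorm (block c) 2 (Measure.count.restrict (Ici i))) ^ 2 := by
  have hlayers := tsum_enorm_pow_le c two_ne_zero (T := (superlevel c i)ᶜ) (L := Ici i)
    fun n hn h₀ => by
      obtain ⟨j, hj⟩ := (hc.eventually_lt_const (enorm_pos.2 h₀)).exists
      obtain ⟨l, hl, hmem⟩ := exists_mem_superlevel_succ_diff c hn hj
      exact ⟨l, hl.1, hmem⟩
  refine hlayers.trans_eq ?_
  have hnorm : eLpNorm (block c) 2 (Measure.count.restrict (Ici i)) ^ 2
      = ∑' l : Ici i, block c l ^ 2 := by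
    have hsq := eLpNorm_rpow_toReal (μ := Measure.count.restrict (Ici i)) two_ne_zero
      ENNReal.ofNat_ne_top (block c)
    rw [← lintegral_indicator .of_discrete, lintegral_count, ← tsum_subtype] at hsq
    simpa using hsq
  rw [mul_pow, hnorm]
  congr! 3 with l
  · norm_num
  · rw [block, mul_pow, ← pow_mul, mul_comm (l : ℕ), pow_mul]
    norm_num

end SeqRearr

/-! ### Orthonormal series -/

section Orthonormal

variable {𝕜 E ι : Type*} [RCLike 𝕜] [NormedAddCommGroup E] [InnerProductSpace 𝕜 E] {v : ι → E}

lemma summable_smul_of_orthonormal [CompleteSpace E] (hv : Orthonormal 𝕜 v) {c : ι → 𝕜}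
    (hc : ∑' n, ‖c n‖ₑ ^ 2 ≠ ∞) : Summable fun n => c n • v n := by
  have hiff := hv.orthogonalFamily.summable_iff_norm_sq_summable c
  simp only [LinearIsometry.toSpanSingleton_apply] at hiff
  simpa [hiff] using ENNReal.summable_toReal hc

lemma enorm_tsum_smul_sq_of_orthonormal (hv : Orthonormal 𝕜 v) {c : ι → 𝕜}
    (hc : Summable fun n => c n • v n) : ‖∑' n, c n • v n‖ₑ ^ 2 = ∑' n, ‖c n‖ₑ ^ 2 := by
  have hfinite (T : Finset ι) : ‖∑ n ∈ T, c n • v n‖ₑ ^ 2 = ∑ n ∈ T, ‖c n‖ₑ ^ 2 := by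
    have hreal := hv.orthogonalFamily.norm_sum c T
    simp only [LinearIsometry.toSpanSingleton_apply] at hreal
    simp only [← ofReal_norm, ← ENNReal.ofReal_pow (norm_nonneg _)]
    rw [hreal, ENNReal.ofReal_sum_of_nonneg fun _ _ => by positivity]
  have hlim := ((ENNReal.continuous_pow 2).comp continuous_enorm).continuousAt.tendsto.comp
    hc.hasSum
  refine tendsto_nhds_unique hlim (ENNReal.summable.hasSum.congr fun T => ?_)
  exact (hfinite T).symm

end Orthonormal

lemma eLpNorm_sum_smul_le {ι X 𝕜 E : Type*} [MeasurableSpace X] {μ : Measure X} {p : ℝ≥0∞}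
    [NormedRing 𝕜] [NormedAddCommGroup E] [Module 𝕜 E] [IsBoundedSMul 𝕜 E]
    {φ : ι → Lp E p μ} {r K : ℝ≥0∞} (hr : 1 ≤ r) (hK : ∀ n, eLpNorm (φ n) r μ ≤ K) (c : ι → 𝕜)
    (T : Finset ι) :
    eLpNorm (∑ n ∈ T, c n • φ n : Lp E p μ) r μ ≤ K * ∑ n ∈ T, ‖c n‖ₑ := by
  rw [eLpNorm_congr_ae (Lp.coeFn_finsetSum T _)]
  refine (eLpNorm_sum_le (fun n _ => Lp.aestronglyMeasurable _) hr).trans ?_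
  rw [Finset.mul_sum]
  refine Finset.sum_le_sum fun n _ => ?_
  rw [eLpNorm_congr_ae (Lp.coeFn_smul (c n) (φ n)), mul_comm]
  exact eLpNorm_const_smul_le.trans (mul_le_mul_right (hK n) _)

section FourierInv

variable {ι : Type*} {φ : ι → Lp ℂ 2 unitVol} {c : ι → ℂ}

/-- The part of the series over `superlevel c i` is estimated uniformly, the rest by Parseval. -/
lemma eLpNorm_fnRearr_fourierInv_le (hφ : Orthonormal ℂ φ) {K : ℝ≥0∞}
    (hK : ∀ n, eLpNorm (φ n) ∞ unitVol ≤ K) (hsum : Summable fun n => c n • φ n)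
    (hc : Tendsto (fun j => seqRearr c (4 ^ j)) atTop (nhds 0)) (t : ℝ) (i : ℕ) :
    eLpNorm (fnRearr (fourierInv φ c)) 2 (volume.restrict (Ioo 0 t))
      ≤ ENNReal.ofReal t ^ recip 2 * (K * (4 * ∑ l ∈ Finset.range i, 2 ^ l * block c l))
        + 2 * eLpNorm (block c) 2 (Measure.count.restrict (Ici i)) := by
  set S := superlevel c i
  have : Fintype S := (finite_superlevel c i).fintype
  have hsplit : fourierInv φ c = (∑' n : S, c n • φ n) + ∑' n : ↥Sᶜ, c n • φ n :=
    (hsum.tsum_subtype_add_tsum_subtype_compl S).symm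
  have hhead : eLpNorm (∑' n : S, c n • φ n : Lp ℂ 2 unitVol) ∞ unitVol
      ≤ K * (4 * ∑ l ∈ Finset.range i, 2 ^ l * block c l) := by
    rw [tsum_fintype]
    refine (eLpNorm_sum_smul_le le_top (fun n : S => hK n) (fun n => c n) _).trans ?_
    gcongr
    exact (tsum_fintype _).symm.trans_le (tsum_superlevel_enorm_le c i)
  have hparseval : ‖∑' n : ↥Sᶜ, c n • φ n‖ₑ ^ 2 = ∑' n : ↥Sᶜ, ‖c n‖ₑ ^ 2 :=
    enorm_tsum_smul_sq_of_orthonormal (hφ.comp _ Subtype.val_injective) (hsum.subtype _)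
  have htail : eLpNorm (∑' n : ↥Sᶜ, c n • φ n : Lp ℂ 2 unitVol) 2 unitVol
      ≤ 2 * eLpNorm (block c) 2 (Measure.count.restrict (Ici i)) := by
    rw [← Lp.enorm_def, ← ENNReal.pow_le_pow_left_iff two_ne_zero, hparseval]
    exact tsum_compl_superlevel_enorm_sq_le c hc i
  refine (eLpNorm_fnRearr_le one_le_two (Lp.stronglyMeasurable _).measurable ?_ t).trans
    (add_le_add (mul_le_mul_right hhead _) htail)
  rw [hsplit]
  exact Lp.coeFn_add _ _

end FourierInv

/-! ### Discretisation of the norms -/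

section LogWeight

variable {x : ℝ} {k : ℕ}

lemma ofReal_rpow_mul_one_add_log_rpow (hx : 1 ≤ x) (a b : ℝ) :
    ENNReal.ofReal (x ^ a * (1 + Real.log x) ^ b)
      = ENNReal.ofReal x ^ a * ENNReal.ofReal (1 + Real.log x) ^ b := by
  have hx₀ : 0 < x := zero_lt_one.trans_le hx
  have hlog := Real.log_nonneg hx
  rw [ENNReal.ofReal_mul (by positivity), ENNReal.ofReal_rpow_of_pos hx₀,
    ENNReal.ofReal_rpow_of_pos (by positivity)]

lemma one_add_log_le_mul (hx : 1 ≤ x) (hxk : x ≤ 4 * 4 ^ k) : 1 + Real.log x ≤ 4 * (k + 1) := by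
  have hlog : Real.log x ≤ (k + 1) * Real.log 4 := by
    rw [← Nat.cast_succ, ← Real.log_pow]
    exact Real.log_le_log (by positivity) (hxk.trans_eq (pow_succ' _ _).symm)
  have hlog4 : Real.log 4 ≤ 3 := (Real.log_le_sub_one_of_pos (by norm_num)).trans (by norm_num)
  nlinarith [k.cast_nonneg (α := ℝ)]

lemma add_one_le_mul_one_add_log (hx : 1 ≤ x) (hkx : 4 ^ k ≤ 4 * x) :
    (k + 1 : ℝ) ≤ 4 * (1 + Real.log x) := by
  have hlog : k * Real.log 4 ≤ Real.log 4 + Real.log x := by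
    rw [← Real.log_pow, ← Real.log_mul (by norm_num) (by positivity)]
    exact Real.log_le_log (by positivity) hkx
  have hlog4 : 1 ≤ Real.log 4 := by
    rw [Real.le_log_iff_exp_le (by norm_num)]
    exact Real.exp_one_lt_three.le.trans (by norm_num)
  nlinarith [k.cast_nonneg (α := ℝ), Real.log_nonneg hx]

lemma ofReal_rpow_le_four_rpow_abs_mul {x y : ℝ} (hxy : x ≤ 4 * y) (hyx : y ≤ 4 * x) (a : ℝ) :
    ENNReal.ofReal x ^ a ≤ 4 ^ |a| * ENNReal.ofReal y ^ a := by
  have hmul (z : ℝ) : ENNReal.ofReal (4 * z) = 4 * ENNReal.ofReal z := by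
    rw [ENNReal.ofReal_mul (by norm_num), ENNReal.ofReal_ofNat]
  exact rpow_le_rpow_abs_mul (by norm_num) (by norm_num)
    ((ENNReal.ofReal_le_ofReal hxy).trans_eq (hmul y))
    ((ENNReal.ofReal_le_ofReal hyx).trans_eq (hmul x)) a

lemma four_pow_rpow_mul_powWeight (a b : ℝ) (k : ℕ) :
    ((4 : ℝ≥0∞) ^ k) ^ a * powWeight b k
      = ENNReal.ofReal (4 ^ k) ^ a * ENNReal.ofReal (k + 1) ^ b := by
  rw [powWeight, ENNReal.ofReal_pow (by norm_num), ENNReal.ofReal_ofNat,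
    ENNReal.ofReal_add (by positivity) zero_le_one, ENNReal.ofReal_natCast, ENNReal.ofReal_one]

lemma ofReal_rpow_mul_one_add_log_rpow_le (hx : 1 ≤ x) (hxk : x ≤ 4 * 4 ^ k) (hkx : 4 ^ k ≤ 4 * x)
    (a b : ℝ) :
    ENNReal.ofReal (x ^ a * (1 + Real.log x) ^ b)
      ≤ 4 ^ (|a| + |b|) * ((4 ^ k) ^ a * powWeight b k) := by
  rw [ofReal_rpow_mul_one_add_log_rpow hx, four_pow_rpow_mul_powWeight,
    ENNReal.rpow_add _ _ (by norm_num) (by norm_num), mul_mul_mul_comm]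
  exact mul_le_mul' (ofReal_rpow_le_four_rpow_abs_mul hxk hkx a)
    (ofReal_rpow_le_four_rpow_abs_mul (one_add_log_le_mul hx hxk)
      (add_one_le_mul_one_add_log hx hkx) b)

lemma four_pow_rpow_mul_powWeight_le (hx : 1 ≤ x) (hxk : x ≤ 4 * 4 ^ k) (hkx : 4 ^ k ≤ 4 * x)
    (a b : ℝ) :
    ((4 : ℝ≥0∞) ^ k) ^ a * powWeight b k
      ≤ 4 ^ (|a| + |b|) * ENNReal.ofReal (x ^ a * (1 + Real.log x) ^ b) := by
  rw [ofReal_rpow_mul_one_add_log_rpow hx, four_pow_rpow_mul_powWeight,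
    ENNReal.rpow_add _ _ (by norm_num) (by norm_num), mul_mul_mul_comm]
  exact mul_le_mul' (ofReal_rpow_le_four_rpow_abs_mul hkx hxk a)
    (ofReal_rpow_le_four_rpow_abs_mul (add_one_le_mul_one_add_log hx hkx)
      (one_add_log_le_mul hx hxk) b)

end LogWeight

/-- The index `k` of the interval `(4^{-(k+1)}, 4^{-k}]` containing `t ∈ (0, 1)`. -/
noncomputable def quarterIndex (t : ℝ) : ℕ := Nat.log 4 ⌊t⁻¹⌋₊

lemma measurable_quarterIndex : Measurable quarterIndex :=
  measurable_from_top.comp (Nat.measurable_floor.comp measurable_inv)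

lemma four_pow_quarterIndex_le {t : ℝ} (ht : t ∈ Ioo 0 1) : 4 ^ quarterIndex t ≤ t⁻¹ := by
  have hfloor : ⌊t⁻¹⌋₊ ≠ 0 := (Nat.floor_pos.2 ((one_le_inv₀ ht.1).2 ht.2.le)).ne'
  have hle := (Nat.le_floor_iff (inv_pos.2 ht.1).le).1 (Nat.pow_log_le_self 4 hfloor)
  exact_mod_cast hle

lemma inv_le_four_mul_four_pow_quarterIndex (t : ℝ) : t⁻¹ ≤ 4 * 4 ^ quarterIndex t := by
  have hlt := (Nat.floor_lt' (by positivity)).1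
    (Nat.lt_pow_succ_log_self (b := 4) (by norm_num) ⌊t⁻¹⌋₊)
  rw [pow_succ'] at hlt
  exact_mod_cast hlt.le

lemma le_quarter_pow_quarterIndex {t : ℝ} (ht : t ∈ Ioo 0 1) : t ≤ (1 / 4) ^ quarterIndex t := by
  rw [one_div, inv_pow, le_inv_comm₀ ht.1 (by positivity)]
  exact four_pow_quarterIndex_le ht

lemma volume_quarterIndex_preimage_le (k : ℕ) :
    (volume.restrict (Ioo 0 1)).restrict (quarterIndex ⁻¹' {k}) univ ≤ ((4 : ℝ≥0∞) ^ k)⁻¹ := by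
  rw [Measure.restrict_apply_univ,
    Measure.restrict_apply (measurable_quarterIndex (measurableSet_singleton k))]
  have hsub : quarterIndex ⁻¹' {k} ∩ Ioo 0 1 ⊆ Icc 0 ((1 / 4) ^ k) := by
    rintro t ⟨rfl : quarterIndex t = k, ht⟩
    exact ⟨ht.1.le, le_quarter_pow_quarterIndex ht⟩
  refine (measure_mono hsub).trans_eq ?_
  rw [Real.volume_Icc, sub_zero, ENNReal.ofReal_pow (by norm_num), one_div,
    ENNReal.ofReal_inv_of_pos (by norm_num), ENNReal.ofReal_ofNat, ENNReal.inv_pow]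

lemma eLpNorm_logWeight_mul_le {q : ℝ≥0∞} (hq : q ≠ 0) (α : ℝ) {A : ℝ → ℝ≥0∞} (hA : Monotone A) :
    eLpNorm (fun t => ENNReal.ofReal (t ^ (-recip q) * (1 + |Real.log t|) ^ α) * A t) q
        (volume.restrict (Ioo 0 1))
      ≤ 4 ^ (recip q + |α|)
        * eLpNorm (fun k : ℕ => powWeight α k * A ((1 / 4) ^ k)) q Measure.count := by
  rw [← eLpNorm_count_eLpNorm_fiber measurable_quarterIndex hq]
  refine eLpNorm_le_mul_eLpNorm_of_ae_le_mul'' q .of_discrete (.of_forall fun k => ?_)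
  rw [enorm_eq_self, enorm_eq_self]
  have hpointwise : ∀ᵐ t ∂(volume.restrict (Ioo 0 1)).restrict (quarterIndex ⁻¹' {k}),
      ENNReal.ofReal (t ^ (-recip q) * (1 + |Real.log t|) ^ α) * A t
        ≤ 4 ^ (recip q + |α|) * ((4 ^ k) ^ recip q * powWeight α k) * A ((1 / 4) ^ k) := by
    filter_upwards [ae_restrict_mem (measurable_quarterIndex (measurableSet_singleton k)),
      ae_restrict_of_ae (ae_restrict_mem measurableSet_Ioo)]
    rintro t (rfl : quarterIndex t = k) ht
    refine mul_le_mul' ?_ (hA (le_quarter_pow_quarterIndex ht))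
    have hone : 1 ≤ t⁻¹ := (one_le_inv₀ ht.1).2 ht.2.le
    have hle := four_pow_quarterIndex_le ht
    have hweight := ofReal_rpow_mul_one_add_log_rpow_le hone
      (inv_le_four_mul_four_pow_quarterIndex t) (hle.trans (by linarith)) (recip q) α
    rwa [Real.inv_rpow ht.1.le, ← Real.rpow_neg ht.1.le, Real.log_inv,
      ← abs_of_neg (Real.log_neg ht.1 ht.2), abs_of_nonneg (recip_nonneg q)] at hweight
  calc _ ≤ (((4 : ℝ≥0∞) ^ k)⁻¹) ^ recip q
        * (4 ^ (recip q + |α|) * ((4 ^ k) ^ recip q * powWeight α k) * A ((1 / 4) ^ k)) :=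
        (eLpNorm_le_of_ae_le_const hq hpointwise).trans <| mul_le_mul_left
          (ENNReal.rpow_le_rpow (volume_quarterIndex_preimage_le k) (recip_nonneg q)) _
    _ = ((((4 : ℝ≥0∞) ^ k)⁻¹) ^ recip q * (4 ^ k) ^ recip q)
        * (4 ^ (recip q + |α|) * (powWeight α k * A ((1 / 4) ^ k))) := by ring
    _ = 4 ^ (recip q + |α|) * (powWeight α k * A ((1 / 4) ^ k)) := by
        rw [← ENNReal.mul_rpow_of_nonneg _ _ (recip_nonneg q),
          ENNReal.inv_mul_cancel (by positivity) (by finiteness), ENNReal.one_rpow, one_mul]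

lemma clog_four_succ_eq {k n : ℕ} (hkn : 4 ^ k / 4 ≤ n) (hnk : n < 4 ^ k) :
    Nat.clog 4 (n + 1) = k := by
  refine le_antisymm (Nat.clog_le_of_le_pow hnk) ?_
  rcases k with _ | k
  · exact Nat.zero_le _
  · rw [Nat.succ_le_iff, Nat.lt_clog_iff_pow_lt (by norm_num)]
    omega

lemma four_pow_rpow_mul_le_eLpNorm_Ico {q : ℝ≥0∞} (hq : q ≠ 0) {k : ℕ} {f : ℕ → ℝ≥0∞}
    {z : ℝ≥0∞} (h : ∀ n ∈ Ico (4 ^ k / 4) (4 ^ k), z ≤ f n) :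
    ((4 : ℝ≥0∞) ^ k) ^ recip q * z
      ≤ 2 ^ recip q * eLpNorm f q (Measure.count.restrict (Ico (4 ^ k / 4) (4 ^ k))) := by
  set μ : Measure ℕ := Measure.count.restrict (Ico (4 ^ k / 4) (4 ^ k)) with hμ
  have hcard : (4 : ℝ≥0∞) ^ k ≤ 2 * μ univ := by
    rw [hμ, Measure.restrict_apply_univ, ← Finset.coe_Ico, Measure.count_apply_finset,
      Nat.card_Ico]
    have : 0 < 4 ^ k := by positivity
    exact_mod_cast (by omega : 4 ^ k ≤ 2 * (4 ^ k - 4 ^ k / 4))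
  have hμ₀ : μ ≠ 0 := fun h => by simp [h] at hcard
  calc ((4 : ℝ≥0∞) ^ k) ^ recip q * z
      ≤ (2 * μ univ) ^ recip q * z :=
        mul_le_mul_left (ENNReal.rpow_le_rpow hcard (recip_nonneg q)) _
    _ = 2 ^ recip q * (μ univ ^ recip q * z) := by
        rw [ENNReal.mul_rpow_of_nonneg _ _ (recip_nonneg q), mul_assoc]
    _ ≤ 2 ^ recip q * eLpNorm f q μ :=
        mul_le_mul_right (rpow_mul_le_eLpNorm_of_ae_const_le hq hμ₀
          ((ae_restrict_mem measurableSet_Ico).mono h)) _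

/-- Only the indices `n ∈ [4^{k-1}, 4^k)`, at least half of all `n < 4^k`, are used to bound the
`k`-th term from above. -/
lemma powWeight_mul_four_pow_rpow_mul_le {q : ℝ≥0∞} (hq : q ≠ 0) (a β : ℝ) {s : ℕ → ℝ≥0∞}
    (hs : Antitone s) (k : ℕ) :
    powWeight β k * (((4 : ℝ≥0∞) ^ k) ^ a * s (4 ^ k))
      ≤ 2 ^ recip q * 4 ^ (|a - recip q| + |β|) *
        eLpNorm (fun n : ℕ => ENNReal.ofReal (((n + 1 : ℕ) : ℝ) ^ (a - recip q)
            * (1 + Real.log ((n + 1 : ℕ) : ℝ)) ^ β) * s (n + 1)) q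
          (Measure.count.restrict ((fun n => Nat.clog 4 (n + 1)) ⁻¹' {k})) := by
  set F : ℕ → ℝ≥0∞ := fun n => ENNReal.ofReal (((n + 1 : ℕ) : ℝ) ^ (a - recip q)
    * (1 + Real.log ((n + 1 : ℕ) : ℝ)) ^ β) * s (n + 1)
  set D : ℝ≥0∞ := 4 ^ (|a - recip q| + |β|)
  have hF (n : ℕ) (hn : n ∈ Ico (4 ^ k / 4) (4 ^ k)) :
      (4 ^ k) ^ (a - recip q) * powWeight β k * s (4 ^ k) ≤ D * F n := by
    obtain ⟨hkn, hnk⟩ := hn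
    rw [← mul_assoc]
    refine mul_le_mul' (four_pow_rpow_mul_powWeight_le ?_ ?_ ?_ _ β) (hs hnk)
    · exact_mod_cast n.succ_pos
    · exact_mod_cast (by omega : n + 1 ≤ 4 * 4 ^ k)
    · exact_mod_cast (by omega : 4 ^ k ≤ 4 * (n + 1))
  have hsub : Ico (4 ^ k / 4) (4 ^ k) ⊆ (fun n => Nat.clog 4 (n + 1)) ⁻¹' {k} := fun n hn =>
    clog_four_succ_eq hn.1 hn.2
  calc powWeight β k * (((4 : ℝ≥0∞) ^ k) ^ a * s (4 ^ k))
      = (4 ^ k) ^ recip q * ((4 ^ k) ^ (a - recip q) * powWeight β k * s (4 ^ k)) := by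
        nth_rw 1 [← add_sub_cancel (recip q) a]
        rw [ENNReal.rpow_add _ _ (by positivity) (by finiteness)]
        ring
    _ ≤ 2 ^ recip q *
        eLpNorm (fun n => D * F n) q (Measure.count.restrict (Ico (4 ^ k / 4) (4 ^ k))) :=
        four_pow_rpow_mul_le_eLpNorm_Ico hq hF
    _ ≤ 2 ^ recip q * (D * eLpNorm F q (Measure.count.restrict (Ico (4 ^ k / 4) (4 ^ k)))) := by
        gcongr
        exact eLpNorm_le_mul_eLpNorm_of_ae_le_mul'' q .of_discrete
          (.of_forall fun n => by simp only [enorm_eq_self, le_refl])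
    _ ≤ _ := by
        rw [mul_assoc]
        gcongr

lemma four_pow_rpow_recip_two (k : ℕ) : ((4 : ℝ≥0∞) ^ k) ^ recip 2 = 2 ^ k := by
  rw [(by norm_num : (4 : ℝ≥0∞) = 2 ^ (2 : ℕ)), ← pow_mul, mul_comm 2 k, pow_mul,
    recip_eq, ENNReal.toReal_ofNat, one_div]
  exact_mod_cast ENNReal.pow_rpow_inv_natCast two_ne_zero (2 ^ k)

lemma exists_eLpNorm_powWeight_mul_block_le {q : ℝ≥0∞} (hq : q ≠ 0) (β : ℝ) :
    ∃ C : ℝ≥0, ∀ {ι : Type*} (c : ι → ℂ),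
      eLpNorm (fun k => powWeight β k * block c k) q Measure.count ≤ C * lzSeqNorm 2 q β c := by
  have htop : (2 : ℝ≥0∞) ^ recip q * 4 ^ (|recip 2 - recip q| + |β|) ≠ ∞ := by
    have := recip_nonneg q
    finiteness
  lift (2 : ℝ≥0∞) ^ recip q * 4 ^ (|recip 2 - recip q| + |β|) to ℝ≥0 using htop with C hC
  refine ⟨C, fun c => ?_⟩
  conv_rhs =>
    rw [lzSeqNorm, ← eLpNorm_count_eLpNorm_fiber
      (measurable_of_countable fun n => Nat.clog 4 (n + 1)) hq]
  refine eLpNorm_le_mul_eLpNorm_of_ae_le_mul' (.of_forall fun k => ?_) q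
  rw [enorm_eq_self, enorm_eq_self, hC, block, ← four_pow_rpow_recip_two]
  exact powWeight_mul_four_pow_rpow_mul_le hq _ β (seqRearr_antitone c) k

lemma eLpNorm_powWeight_mul_sub_le {q : ℝ≥0∞} (hq : q ≠ 0) (α : ℝ) (m : ℕ) (U : ℕ → ℝ≥0∞) :
    eLpNorm (fun j => powWeight α j * U (j - m)) q Measure.count
      ≤ powWeight (|α| + recip q) m * eLpNorm (fun i => powWeight α i * U i) q Measure.count := by
  have hfiber (i : ℕ) : Measure.count ((fun j => j - m) ⁻¹' {i}) ≤ ((m + 1 : ℕ) : ℝ≥0) := by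
    have hsub : (fun j => j - m) ⁻¹' {i} ⊆ (Finset.Icc i (i + m) : Finset ℕ) := by
      rintro j (rfl : j - m = i)
      simp only [Finset.coe_Icc, mem_Icc]
      omega
    refine (measure_mono hsub).trans_eq ?_
    rw [Measure.count_apply_finset, Nat.card_Icc, add_assoc, add_tsub_cancel_left]
    rfl
  calc eLpNorm (fun j => powWeight α j * U (j - m)) q Measure.count
      ≤ powWeight |α| m
        * eLpNorm (fun j => powWeight α (j - m) * U (j - m)) q Measure.count := by
        refine eLpNorm_le_mul_eLpNorm_of_ae_le_mul'' q .of_discrete (.of_forall fun j => ?_)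
        rw [enorm_eq_self, enorm_eq_self, ← mul_assoc]
        gcongr
        exact powWeight_le_mul_of_le_add α (Nat.sub_le j m) le_tsub_add
    _ ≤ powWeight |α| m * (((m + 1 : ℕ) : ℝ≥0) ^ recip q
        * eLpNorm (fun i => powWeight α i * U i) q Measure.count) := by
        gcongr
        exact eLpNorm_comp_le (measurable_of_countable _) hq hfiber fun i => powWeight α i * U i
    _ = _ := by
        rw [powWeight, powWeight, ENNReal.rpow_add _ _ (by simp) (by finiteness)]
        push_cast
        ring

/-! ### The estimate for the synthesis operator -/

section Finiteness

variable {ι : Type*} {c : ι → ℂ}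

lemma eLpNorm_block_two_ne_top {q : ℝ≥0∞} (hq : q ≠ 0) {α : ℝ} (hα : -recip q < α)
    (hc : c ∈ lzSeq ι 2 q (α + recip (min q 2))) : eLpNorm (block c) 2 Measure.count ≠ ∞ := by
  obtain ⟨C₁, hTail⟩ := exists_eLpNorm_powWeight_mul_eLpNorm_Ici_le hq one_le_two hα
  obtain ⟨C₂, hBlock⟩ := exists_eLpNorm_powWeight_mul_block_le hq (α + recip (min q 2))
  have hzero := le_eLpNorm_count hq (fun i : ℕ => powWeight α i
    * eLpNorm (block c) 2 (Measure.count.restrict (Ici i))) 0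
  have hIci : Ici (0 : ℕ) = univ := Ici_bot
  simp only [powWeight, Nat.cast_zero, zero_add, ENNReal.one_rpow, one_mul, hIci,
    Measure.restrict_univ] at hzero
  have hnorm : lzSeqNorm 2 q (α + recip (min q 2)) c ≠ ∞ := ne_of_lt hc
  have hfinite : C₁ * (C₂ * lzSeqNorm 2 q (α + recip (min q 2)) c) ≠ ∞ :=
    ENNReal.mul_ne_top ENNReal.coe_ne_top (ENNReal.mul_ne_top ENNReal.coe_ne_top hnorm)
  exact ne_top_of_le_ne_top hfinite <| hzero.trans <| (hTail (block c)).trans <|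
    mul_le_mul_right (hBlock c) _

lemma tendsto_seqRearr_four_pow (h : eLpNorm (block c) 2 Measure.count ≠ ∞) :
    Tendsto (fun j => seqRearr c (4 ^ j)) atTop (nhds 0) := by
  have hle (j : ℕ) : seqRearr c (4 ^ j) ≤ 2⁻¹ ^ j * eLpNorm (block c) 2 Measure.count := by
    rw [← ENNReal.inv_pow, ← ENNReal.mul_le_iff_le_inv (by simp) (by simp)]
    exact le_eLpNorm_count two_ne_zero (block c) j
  have hpow : Tendsto (fun j : ℕ => (2⁻¹ : ℝ≥0∞) ^ j * eLpNorm (block c) 2 Measure.count) atTop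
      (nhds 0) := by
    simpa using ENNReal.Tendsto.mul_const
      (ENNReal.tendsto_pow_atTop_nhds_zero_of_lt_one ENNReal.one_half_lt_one) (.inr h)
  exact tendsto_of_tendsto_of_tendsto_of_le_of_le tendsto_const_nhds hpow (fun _ => zero_le) hle

lemma tsum_enorm_sq_ne_top (h : eLpNorm (block c) 2 Measure.count ≠ ∞) :
    ∑' n, ‖c n‖ₑ ^ 2 ≠ ∞ := by
  have htail := tsum_compl_superlevel_enorm_sq_le c (tendsto_seqRearr_four_pow h) 0
  have hIci : Ici (0 : ℕ) = univ := Ici_bot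
  rw [superlevel_zero, compl_empty, tsum_univ fun n => ‖c n‖ₑ ^ 2, hIci,
    Measure.restrict_univ] at htail
  exact ne_top_of_le_ne_top (by finiteness) htail

end Finiteness

/-- The bound for `‖f^*‖_{L_2(0,t)}` by the blocks `b` of the coefficients: the weighted `l_1` sum
of the blocks below `i` comes from the largest coefficients, the `l_2` norm of the other blocks from
Parseval's identity. -/
noncomputable def headTail (b : ℕ → ℝ≥0∞) (i : ℕ) : ℝ≥0∞ :=
  4 * ∑ l ∈ Finset.range i, 2⁻¹ ^ (i - l) * b l + 2 * eLpNorm b 2 (Measure.count.restrict (Ici i))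

lemma exists_eLpNorm_powWeight_mul_headTail_le {q : ℝ≥0∞} (hq : q ≠ 0) {α : ℝ}
    (hα : -recip q < α) :
    ∃ C : ℝ≥0, ∀ b : ℕ → ℝ≥0∞,
      eLpNorm (fun i => powWeight α i * headTail b i) q Measure.count
        ≤ C * eLpNorm (fun i => powWeight (α + recip (min q 2)) i * b i) q Measure.count := by
  obtain ⟨C₁, hHead⟩ :=
    exists_eLpNorm_powWeight_mul_sum_geometric_le hq α ENNReal.one_half_lt_one
  obtain ⟨C₂, hTail⟩ := exists_eLpNorm_powWeight_mul_eLpNorm_Ici_le hq one_le_two hα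
  lift q.LpAddConst to ℝ≥0 using q.LpAddConst_lt_top.ne with A hA
  refine ⟨A * (4 * C₁ + 2 * C₂), fun b => ?_⟩
  set N := eLpNorm (fun i => powWeight (α + recip (min q 2)) i * b i) q Measure.count
  have hN : eLpNorm (fun i => powWeight α i * b i) q Measure.count ≤ N :=
    eLpNorm_mono_enorm fun i => mul_le_mul_left
      (ENNReal.rpow_le_rpow_of_exponent_le (by simp) (by linarith [recip_nonneg (min q 2)])) _
  have hhead : eLpNorm (fun i => 4 * (powWeight α i *
      ∑ l ∈ Finset.range i, 2⁻¹ ^ (i - l) * b l)) q Measure.count ≤ 4 * (C₁ * N) := by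
    refine (eLpNorm_le_mul_eLpNorm_of_ae_le_mul'' q .of_discrete (.of_forall fun i => ?_)).trans
      (mul_le_mul_right ((hHead b).trans (mul_le_mul_right hN _)) _)
    simp only [enorm_eq_self]
    gcongr
    exact i.le_succ
  have htail : eLpNorm (fun i => 2 * (powWeight α i *
      eLpNorm b 2 (Measure.count.restrict (Ici i)))) q Measure.count ≤ 2 * (C₂ * N) :=
    (eLpNorm_le_mul_eLpNorm_of_ae_le_mul'' q .of_discrete (.of_forall fun _ => le_rfl)).trans
      (mul_le_mul_right (hTail b) _)
  calc eLpNorm (fun i => powWeight α i * headTail b i) q Measure.count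
      ≤ A * (4 * (C₁ * N) + 2 * (C₂ * N)) := by
        rw [hA]
        simp only [headTail, mul_add (powWeight α _), mul_left_comm (powWeight α _)]
        exact (eLpNorm_add_le' .of_discrete .of_discrete q).trans
          (mul_le_mul_right (add_le_add hhead htail) _)
    _ = (A * (4 * C₁ + 2 * C₂) : ℝ≥0) * N := by push_cast; ring

lemma ofReal_quarter_pow_rpow_recip_two (j : ℕ) :
    ENNReal.ofReal ((1 / 4) ^ j) ^ recip 2 = 2⁻¹ ^ j := by
  rw [one_div, inv_pow, ENNReal.ofReal_inv_of_pos (by positivity),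
    ENNReal.ofReal_pow (by norm_num), ENNReal.ofReal_ofNat, ENNReal.inv_rpow,
    four_pow_rpow_recip_two, ENNReal.inv_pow]

lemma half_pow_mul_sum_two_pow_mul (m i : ℕ) (b : ℕ → ℝ≥0∞) :
    2⁻¹ ^ (i + m) * (2 ^ m * (4 * ∑ l ∈ Finset.range i, 2 ^ l * b l))
      = 4 * ∑ l ∈ Finset.range i, 2⁻¹ ^ (i - l) * b l := by
  have hcancel (k : ℕ) : (2⁻¹ : ℝ≥0∞) ^ k * 2 ^ k = 1 := by
    rw [← mul_pow, ENNReal.inv_mul_cancel (by norm_num) (by norm_num), one_pow]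
  calc 2⁻¹ ^ (i + m) * (2 ^ m * (4 * ∑ l ∈ Finset.range i, 2 ^ l * b l))
      = 2⁻¹ ^ m * 2 ^ m * (4 * ∑ l ∈ Finset.range i, 2⁻¹ ^ i * (2 ^ l * b l)) := by
        rw [pow_add, ← Finset.mul_sum]; ring
    _ = 4 * ∑ l ∈ Finset.range i, 2⁻¹ ^ i * (2 ^ l * b l) := by rw [hcancel, one_mul]
    _ = 4 * ∑ l ∈ Finset.range i, 2⁻¹ ^ (i - l) * b l := by
        congr 1
        refine Finset.sum_congr rfl fun l hl => ?_
        rw [← Nat.sub_add_cancel (Finset.mem_range.1 hl).le, pow_add, add_tsub_cancel_right,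
          mul_assoc, ← mul_assoc (2⁻¹ ^ l), hcancel, one_mul]

section Synthesis

variable {ι : Type*} {φ : ι → Lp ℂ 2 unitVol} {c : ι → ℂ} {m : ℕ}

/-- The coefficients are split at the `4^i`-th largest with the truncated difference `i = j - m`;
the shift by `m` absorbs the bound `2^m` of the system. -/
lemma eLpNorm_fnRearr_fourierInv_quarter_pow_le (hφ : Orthonormal ℂ φ)
    (hm : ∀ n, eLpNorm (φ n) ∞ unitVol ≤ 2 ^ m) (hc : eLpNorm (block c) 2 Measure.count ≠ ∞)
    (j : ℕ) :
    eLpNorm (fnRearr (fourierInv φ c)) 2 (volume.restrict (Ioo 0 ((1 / 4) ^ j)))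
      ≤ headTail (block c) (j - m) := by
  refine (eLpNorm_fnRearr_fourierInv_le hφ hm
    (summable_smul_of_orthonormal hφ (tsum_enorm_sq_ne_top hc)) (tendsto_seqRearr_four_pow hc)
    _ (j - m)).trans ?_
  rw [headTail, ofReal_quarter_pow_rpow_recip_two]
  gcongr ?_ + _
  rcases le_total j m with hjm | hmj
  · simp [Nat.sub_eq_zero_of_le hjm]
  · rw [← half_pow_mul_sum_two_pow_mul m, Nat.sub_add_cancel hmj]

lemma leftNorm_two_two (q : ℝ≥0∞) (α : ℝ) (f : ℝ → ℂ) :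
    leftNorm 2 q α 2 f = eLpNorm (fun t => ENNReal.ofReal (t ^ (-recip q) * (1 + |Real.log t|) ^ α)
      * eLpNorm (fnRearr f) 2 (volume.restrict (Ioo 0 t))) q (volume.restrict (Ioo 0 1)) := by
  simp [leftNorm]

lemma exists_leftNorm_fourierInv_le {q : ℝ≥0∞} (hq : q ≠ 0) {α : ℝ} (hα : -recip q < α) :
    ∃ C : ℝ≥0, ∀ {ι : Type*} {φ : ι → Lp ℂ 2 unitVol} {m : ℕ} {c : ι → ℂ}, Orthonormal ℂ φ →
      (∀ n, eLpNorm (φ n) ∞ unitVol ≤ 2 ^ m) → c ∈ lzSeq ι 2 q (α + recip (min q 2)) →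
      leftNorm 2 q α 2 (fourierInv φ c)
        ≤ C * (powWeight (|α| + recip q) m * lzSeqNorm 2 q (α + recip (min q 2)) c) := by
  obtain ⟨C₁, hHardy⟩ := exists_eLpNorm_powWeight_mul_headTail_le hq hα
  obtain ⟨C₂, hBlock⟩ := exists_eLpNorm_powWeight_mul_block_le hq (α + recip (min q 2))
  have htop : (4 : ℝ≥0∞) ^ (recip q + |α|) ≠ ∞ := by
    have := add_nonneg (recip_nonneg q) (abs_nonneg α)
    finiteness
  lift (4 : ℝ≥0∞) ^ (recip q + |α|) to ℝ≥0 using htop with C₀ hC₀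
  refine ⟨C₀ * C₁ * C₂, fun {ι φ m c} hφ hm hc => ?_⟩
  have hmono : Monotone fun t : ℝ =>
      eLpNorm (fnRearr (fourierInv φ c)) 2 (volume.restrict (Ioo 0 t)) := fun s t hst =>
    eLpNorm_mono_measure _ (Measure.restrict_mono_set _ (Ioo_subset_Ioo_right hst))
  rw [leftNorm_two_two]
  calc _ ≤ C₀ * eLpNorm (fun j : ℕ => powWeight α j
        * eLpNorm (fnRearr (fourierInv φ c)) 2 (volume.restrict (Ioo 0 ((1 / 4) ^ j)))) q
          Measure.count := hC₀ ▸ eLpNorm_logWeight_mul_le hq α hmono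
    _ ≤ C₀ * eLpNorm (fun j => powWeight α j * headTail (block c) (j - m)) q Measure.count := by
        gcongr
        exact eLpNorm_mono_enorm fun j => mul_le_mul_right
          (eLpNorm_fnRearr_fourierInv_quarter_pow_le hφ hm (eLpNorm_block_two_ne_top hq hα hc) j) _
    _ ≤ C₀ * (powWeight (|α| + recip q) m
        * eLpNorm (fun i => powWeight α i * headTail (block c) i) q Measure.count) := by
        gcongr
        exact eLpNorm_powWeight_mul_sub_le hq α m _
    _ ≤ C₀ * (powWeight (|α| + recip q) m
        * (C₁ * (C₂ * lzSeqNorm 2 q (α + recip (min q 2)) c))) := by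
        gcongr
        exact (hHardy (block c)).trans (mul_le_mul_right (hBlock c) _)
    _ = _ := by push_cast; ring

end Synthesis

section SystemBound

lemma one_le_of_orthonormal_of_eLpNorm_top_le {ι : Type*} {φ : ι → Lp ℂ 2 unitVol}
    (hφ : Orthonormal ℂ φ) {M : ℝ} {n : ι} (h : eLpNorm (φ n) ∞ unitVol ≤ ENNReal.ofReal M) :
    1 ≤ M := by
  have : IsProbabilityMeasure unitVol := ⟨by simp⟩
  rw [← ENNReal.one_le_ofReal]
  calc 1 = ‖φ n‖ₑ := by rw [← ofReal_norm, hφ.norm_eq_one, ENNReal.ofReal_one]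
    _ = eLpNorm (φ n) 2 unitVol := Lp.enorm_def _
    _ ≤ eLpNorm (φ n) ∞ unitVol :=
      eLpNorm_le_eLpNorm_of_exponent_le le_top (Lp.aestronglyMeasurable _)
    _ ≤ ENNReal.ofReal M := h

lemma exists_one_add_log_rpow_le {γ : ℝ} (hγ : 0 ≤ γ) :
    ∃ C : ℝ, 1 ≤ C ∧ ∀ M : ℝ, 1 ≤ M → (1 + Real.log M) ^ γ ≤ C * M := by
  set g := max γ 1
  have hg : 0 < g := zero_lt_one.trans_le (le_max_right γ 1)
  refine ⟨(1 + g) ^ γ, Real.one_le_rpow (by linarith) hγ, fun M hM => ?_⟩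
  have hlog := Real.log_nonneg hM
  have hroot : 1 ≤ M ^ g⁻¹ := Real.one_le_rpow hM (by positivity)
  calc (1 + Real.log M) ^ γ ≤ ((1 + g) * M ^ g⁻¹) ^ γ := by
        gcongr
        have hle := Real.log_le_rpow_div (by linarith : 0 ≤ M) (inv_pos.2 hg)
        rw [div_inv_eq_mul] at hle
        linarith
    _ = (1 + g) ^ γ * M ^ (g⁻¹ * γ) := by
        rw [Real.mul_rpow (by positivity) (by positivity), Real.rpow_mul (by positivity)]
    _ ≤ (1 + g) ^ γ * M := by
        gcongr
        refine (Real.rpow_le_rpow_of_exponent_le hM ?_).trans_eq (Real.rpow_one M)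
        exact (inv_mul_le_one₀ hg).2 (le_max_left γ 1)

/-- The exponent `m = ⌈2 log M⌉` serves for both bounds, as `2 log 2 > 1`. -/
lemma exists_le_two_pow_and_powWeight_le {γ δ : ℝ} (hγ : 0 ≤ γ) (hγδ : γ ≤ δ) :
    ∃ C : ℝ, 0 < C ∧ ∀ M : ℝ, 1 ≤ M → ∃ m : ℕ, M ≤ 2 ^ m ∧
      powWeight γ m ≤ ENNReal.ofReal (C * min M ((1 + Real.log M) ^ δ)) := by
  obtain ⟨C, hC, hlogC⟩ := exists_one_add_log_rpow_le hγ
  refine ⟨2 ^ γ * C, by positivity, fun M hM => ⟨⌈2 * Real.log M⌉₊, ?_, ?_⟩⟩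
  all_goals have hlog := Real.log_nonneg hM
  · have hceil := Nat.le_ceil (2 * Real.log M)
    rw [← Real.log_le_log_iff (by linarith) (by positivity), Real.log_pow]
    nlinarith [Real.log_two_gt_d9]
  · set L := 1 + Real.log M
    have hL : 1 ≤ L := le_add_of_nonneg_right hlog
    have hceil : (⌈2 * Real.log M⌉₊ : ℝ) + 1 ≤ 2 * L := by
      linarith [Nat.ceil_lt_add_one (by positivity : 0 ≤ 2 * Real.log M)]
    rw [powWeight, ← ENNReal.ofReal_natCast, ← ENNReal.ofReal_one,
      ← ENNReal.ofReal_add (by positivity) zero_le_one, ENNReal.ofReal_rpow_of_pos (by positivity)]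
    refine ENNReal.ofReal_le_ofReal ?_
    calc ((⌈2 * Real.log M⌉₊ : ℝ) + 1) ^ γ ≤ (2 * L) ^ γ := by gcongr
      _ = 2 ^ γ * L ^ γ := Real.mul_rpow zero_le_two (by positivity)
      _ ≤ 2 ^ γ * min (C * M) (C * L ^ δ) := by
        gcongr
        refine le_min (hlogC M hM) ?_
        exact (Real.rpow_le_rpow_of_exponent_le hL hγδ).trans
          (le_mul_of_one_le_left (by positivity) hC)
      _ = 2 ^ γ * C * min M (L ^ δ) := by
        rw [← mul_min_of_nonneg _ _ (by positivity), mul_assoc]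

end SystemBound

theorem corollary4p1_general {q : ℝ≥0∞} (hq : q ≠ 0) {α : ℝ} (hα : -recip q < α) {ε : ℝ}
    (hε : 0 ≤ ε) :
    ∃ C : ℝ, 0 < C ∧
      ∀ (ι : Type*) [Nonempty ι] (φ : ι → Lp ℂ 2 unitVol) (M : ℝ),
        Orthonormal ℂ φ →
        (∀ n, eLpNorm (φ n) ∞ unitVol ≤ ENNReal.ofReal M) →
        ∀ c ∈ lzSeq ι 2 q (α + recip (min q 2)),
          Summable (fun n => c n • φ n) ∧
          (fourierInv φ c : ℝ → ℂ) ∈ leftSpace 2 q α 2 ∧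
          leftNorm 2 q α 2 (fourierInv φ c) ≤
            ENNReal.ofReal (C * min M ((1 + Real.log M) ^ (|α| + ε + recip q)))
              * lzSeqNorm 2 q (α + recip (min q 2)) c := by
  obtain ⟨C₁, hSynthesis⟩ := exists_leftNorm_fourierInv_le hq hα
  obtain ⟨C₂, hC₂, hSystem⟩ := exists_le_two_pow_and_powWeight_le
    (add_nonneg (abs_nonneg α) (recip_nonneg q)) (by linarith : _ ≤ |α| + ε + recip q)
  refine ⟨(C₁ + 1) * C₂, by positivity, fun ι _ φ M hφ hM c hc => ?_⟩
  obtain ⟨m, hMm, hm⟩ := hSystem M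
    (one_le_of_orthonormal_of_eLpNorm_top_le hφ (hM (Classical.arbitrary ι)))
  have hbound (n : ι) : eLpNorm (φ n) ∞ unitVol ≤ 2 ^ m := by
    refine (hM n).trans ((ENNReal.ofReal_le_ofReal hMm).trans_eq ?_)
    rw [ENNReal.ofReal_pow zero_le_two, ENNReal.ofReal_ofNat]
  have hnorm : leftNorm 2 q α 2 (fourierInv φ c) ≤
      ENNReal.ofReal ((C₁ + 1) * C₂ * min M ((1 + Real.log M) ^ (|α| + ε + recip q)))
        * lzSeqNorm 2 q (α + recip (min q 2)) c := by
    refine (hSynthesis hφ hbound hc).trans ?_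
    rw [← mul_assoc, mul_assoc _ C₂, ENNReal.ofReal_mul (by positivity)]
    gcongr
    rw [← ENNReal.ofReal_coe_nnreal]
    exact ENNReal.ofReal_le_ofReal (by linarith)
  have hsum := summable_smul_of_orthonormal hφ
    (tsum_enorm_sq_ne_top (eLpNorm_block_two_ne_top hq hα hc))
  exact ⟨hsum, ⟨Lp.aestronglyMeasurable _,
    hnorm.trans_lt (ENNReal.mul_lt_top ENNReal.ofReal_lt_top hc)⟩, hnorm⟩

theorem corollary4p1 (q : ℝ≥0∞) (hq : q ≠ 0) (α : ℝ) (hα : -recip q < α)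
    (ε : ℝ) (hε : 0 < ε) :
    ∃ C : ℝ, 0 < C ∧
      ∀ (ι : Type) [Countable ι] [Infinite ι] (φ : ι → Lp ℂ 2 unitVol) (M : ℝ),
        Orthonormal ℂ φ →
        ⨆ n, eLpNorm (φ n) ∞ unitVol = ENNReal.ofReal M →
        ∀ c ∈ lzSeq ι 2 q (α + recip (min q 2)),
          Summable (fun n => c n • φ n) ∧
          (fourierInv φ c : ℝ → ℂ) ∈ leftSpace 2 q α 2 ∧
          leftNorm 2 q α 2 (fourierInv φ c) ≤
            ENNReal.ofReal (C * min M ((1 + Real.log M) ^ (|α| + ε + recip q)))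
              * lzSeqNorm 2 q (α + recip (min q 2)) c := by
  obtain ⟨C, hC, h⟩ := corollary4p1_general hq hα hε.le
  exact ⟨C, hC, fun ι _ _ φ M hφ hM => h ι φ M hφ fun n => (le_iSup _ n).trans_eq hM⟩
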